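/- Setting. A seller has $k$ identical items, and there are $n$ unit-demand buyers whose valuations $v_1,\dots,v_n\ge 0$ are i.i.d. with distribution $F$. Fix $\lambda\in[0,1)$. All distributions $F$ considered have a density $f$ that vanishes outside the support $[\underline v,\overline v]$ ($0\le\underline v<\overline v\le\infty$), is positive on its interior, and is $\lambda$-regular: $\lambda v-\frac{1-F(v)}{f(v)}$ is nondecreasing on the interior of the support. Put $c(\lambda)=(1-\lambda)^{1/\lambda}$ for $\lambda>0$ and $c(0)=1/e$. For valuations $(v_i)_{i\in S}$ of a set $S$ of buyers let $V(x;v_S)=\max\{\sum_{i\in S}v_iz_i : z\in[0,1]^S,\ \sum_{i\in S} z_i\le x\}$, and let $\mathrm{Wel}(F)=\mathbb E[V(k;v_1,\dots,v_n)]$ be the expected optimal welfare. A demand structure $D=(m,\pi)$ is a partition of the buyers into nonempty sets $\pi(1),\dots,\pi(m)$; intermediary $l$ represents the buyers in $\pi(l)$. For every $F$ and $D$, each intermediary $l$ has a measurable utility function $U_l(x,p;v_l)$ of the number $x\in\{0,\dots,k\}$ of items it gets, its payment $p\ge0$ and the valuations $v_l=(v_i)_{i\in\pi(l)}$, such that 1.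 $U_l(0,0;v_l)=0$; 2. $U_l(x,p;v_l)\le V(x;v_l)-p$; 3. there is $\tau_l\in(0,1]$ such that, whenever up to $s\le k$ items are available at a uniform price $r\ge0$ per item, some measurable utility-maximizing demand $d(v_l)\in\arg\max_{0\le x\le s}U_l(x,rx;v_l)$ satisfies $\mathbb E[d(v_l)]\ge\tau_l\,\mathbb E\big[\min\{s,\,|\{i\in\pi(l):v_i\ge r\}|\}\big]$. Utilities are extended to lotteries over $x$ by taking expectations. A direct mechanism for $D$ maps each profile $v$ of reported valuations measurably to a lottery over allocations $(x_1,\dots,x_m)\in\{0,\dots,k\}^m$ and to payments $p_l(v)\ge0$. It is BIC for $(F,D)$ if almost surely $\sum_l x_l\le k$, and for every $l$ and almost every $v_l$ the expected utility of $l$ given $v_l$ under truthful reporting is finite, nonnegative, and at least the one from reporting any other $v_l'$ in the type space. Its revenue $\mathrm{Rev}(F,D;\cdot)$ is $\mathbb E[\sum_l p_l(v)]$, and $\mathrm{Rev}(F,D)$ is the supremum of the revenues of the mechanisms that are BIC for $(F,D)$. A mechanism $(\mathbf x,\mathbf p)$ that is run under every $F$ and $D$ is given by its direct forms, which are BIC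 for the respective $(F,D)$. For $\beta\ge 0$ it is $\beta$-robust if $\mathrm{Rev}(F,D';(\mathbf x,\mathbf p))\ge\beta\,\mathrm{Rev}(F,D;(\mathbf x,\mathbf p))$ for all $F,D,D'$. Proposition. Let $(\mathbf x,\mathbf p)$ be $\beta$-robust, let $\gamma\ge0$, let $\overline D=(\overline m,\overline\pi)$ be a demand structure and $F$ a distribution with $\mathrm{Rev}(F,\overline D;(\mathbf x,\mathbf p))\ge\gamma\,\mathrm{Rev}(F,\overline D)$, and let $\tau=\min_{l\le\overline m}\tau_l$ be the minimum of the constants in condition 3 over the intermediaries of $\overline D$ under $F$. Then for every demand structure $D$ $$\mathrm{Rev}(F,D;(\mathbf x,\mathbf p))\ \ge\ \beta\gamma\tau\,\frac{c(\lambda)}2\Big(1-\frac1e\Big)\mathrm{Wel}(F)\ \ge\ \beta\gamma\tau\,\frac{c(\lambda)}2\Big(1-\frac1e\Big)\mathrm{Rev}(F,D).$$ -/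

import Mathlib

open MeasureTheory ProbabilityTheory
open scoped ENNReal NNReal

noncomputable section

namespace RobustAuction

/-- A valuation distribution on the nonnegative reals: a probability density that is positive
between `lo` and `hi` (where `hi` may be infinite) and vanishes outside `[lo, hi]`. -/
structure ValueDist where
  density : ℝ → ℝ
  lo : ℝ
  hi : EReal
  lo_nonneg : 0 ≤ lo
  lo_lt_hi : (lo : EReal) < hi
  density_measurable : Measurable density
  density_nonneg : ∀ v, 0 ≤ density v
  density_pos : ∀ v : ℝ, lo < v → (v : EReal) < hi → 0 < density v
  density_eq_zero : ∀ v : ℝ, v < lo ∨ hi < (v : EReal) → density v = 0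
  lintegral_density : ∫⁻ v, ENNReal.ofReal (density v) = 1

/-- The law of one valuation. -/
def ValueDist.law (F : ValueDist) : Measure ℝ :=
  volume.withDensity fun v => ENNReal.ofReal (F.density v)

instance (F : ValueDist) : IsProbabilityMeasure F.law := by
  constructor
  rw [ValueDist.law, withDensity_apply _ MeasurableSet.univ, Measure.restrict_univ]
  exact F.lintegral_density

/-- The support `[lo, hi]`, as a set of real numbers. -/
def ValueDist.support (F : ValueDist) : Set ℝ := {v | F.lo ≤ v ∧ (v : EReal) ≤ F.hi}

/-- Independent draws from `F`, one for each element of `ι`. -/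
def ValueDist.iid (F : ValueDist) (ι : Type) [Fintype ι] : Measure (ι → ℝ) :=
  Measure.pi fun _ => F.law

/-- Valuation vectors all of whose entries lie in the support of `F`. -/
def ValueDist.types (F : ValueDist) (ι : Type) : Set (ι → ℝ) := {t | ∀ i, t i ∈ F.support}

/-- The `lam`-regular distributions: `lam * v - (1 - F v) / f v` is nondecreasing on the support.
For `lam = 0` this is a monotone hazard rate, for `lam = 1` it is Myerson regularity. -/
structure RegularDist (lam : ℝ) extends ValueDist where
  regular : MonotoneOn
    (fun v : ℝ => lam * v - (1 - cdf toValueDist.law v) / density v)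
    {v : ℝ | lo < v ∧ (v : EReal) < hi}

/-- `c(lam) = (1 - lam) ^ (1 / lam)`, with its limit `1 / e` at `lam = 0`. -/
def c (lam : ℝ) : ℝ := if lam = 0 then Real.exp (-1) else (1 - lam) ^ (1 / lam)

/-- The largest value that a set `ι` of unit-demand buyers with valuations `v` can create from
`x` items: the maximum of `∑ v i * z i` over `z ∈ [0,1]^ι` with `∑ z i ≤ x`. -/
def surplus {ι : Type} [Fintype ι] (x : ℕ) (v : ι → ℝ) : ℝ :=
  sSup ((fun z : ι → ℝ => ∑ i, v i * z i) ''
    {z | (∀ i, z i ∈ Set.Icc (0 : ℝ) 1) ∧ ∑ i, z i ≤ (x : ℝ)})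

/-- The expected optimal welfare from `k` items and `n` buyers. -/
def welfare (F : ValueDist) (n k : ℕ) : ℝ≥0∞ :=
  ∫⁻ v, ENNReal.ofReal (surplus k v) ∂(F.iid (Fin n))

/-- A demand structure: a partition of the `n` buyers among `m` intermediaries, given by the map
that sends a buyer to its representative (no part is empty, so that `m ≤ n`). -/
structure DemandStructure (n : ℕ) where
  m : ℕ
  rep : Fin n → Fin m
  rep_surjective : Function.Surjective rep

/-- The set of buyers whom intermediary `l` represents. -/
abbrev DemandStructure.Part {n : ℕ} (D : DemandStructure n) (l : Fin D.m) : Type :=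
  {i : Fin n // D.rep i = l}

/-- The utility `U x p t` of intermediary `l` from `x` items at a total price `p`, when the
valuations of its buyers are `t`. -/
abbrev Utility {n : ℕ} (D : DemandStructure n) (l : Fin D.m) : Type :=
  ℕ → ℝ≥0 → (D.Part l → ℝ) → ℝ

/-- The number of entries of `t` that are at least `r`. -/
def numAbove {ι : Type} [Fintype ι] (r : ℝ≥0) (t : ι → ℝ) : ℕ := Nat.card {i : ι // (r : ℝ) ≤ t i}

/-- `d` is an optimal demand (with some measurable tie-breaking) of an intermediary with utility
`U`, when up to `s` items are available at the uniform price `r` per item. -/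
structure IsDemand (F : ValueDist) {n : ℕ} {D : DemandStructure n} {l : Fin D.m}
    (U : Utility D l) (r : ℝ≥0) (s : ℕ) (d : (D.Part l → ℝ) → ℕ) : Prop where
  measurable : Measurable d
  le_supply : ∀ t, d t ≤ s
  optimal : ∀ t ∈ F.types (D.Part l), ∀ x ≤ s, U x (x * r) t ≤ U (d t) (d t * r) t

/-- The three conditions on the utility of an intermediary when there are `k` items:
opting out gives zero, no value is created, and at every uniform price `r` the intermediary wants,
in expectation, at least `τ` times as many of the available items as there are buyers in its part
with valuation at least `r` (but no more of them than are available). -/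
structure IsAdmissible (F : ValueDist) {n : ℕ} (k : ℕ) {D : DemandStructure n} {l : Fin D.m}
    (U : Utility D l) (τ : ℝ) : Prop where
  measurable : ∀ x, Measurable fun y : ℝ≥0 × (D.Part l → ℝ) => U x y.1 y.2
  opt_out : ∀ t ∈ F.types (D.Part l), U 0 0 t = 0
  no_value_created : ∀ t ∈ F.types (D.Part l), ∀ x ≤ k, ∀ p : ℝ≥0, U x p t ≤ surplus x t - p
  tau_pos : 0 < τ
  tau_le_one : τ ≤ 1
  buyer_disconnectability : ∀ r : ℝ≥0, ∀ s ≤ k, ∃ d, IsDemand F U r s d ∧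
    τ * ∫ t, ((min (numAbove r t) s : ℕ) : ℝ) ∂(F.iid (D.Part l)) ≤
      ∫ t, (d t : ℝ) ∂(F.iid (D.Part l))

/-- A direct mechanism for `k` items: every profile of reported valuations is mapped to a lottery
over the numbers of items that the intermediaries get, and to their nonnegative payments. -/
structure Mechanism {n : ℕ} (k : ℕ) (D : DemandStructure n) where
  alloc : (Fin n → ℝ) → PMF (Fin D.m → Fin (k + 1))
  pay : Fin D.m → (Fin n → ℝ) → ℝ≥0
  alloc_measurable : ∀ a, Measurable fun v => alloc v a
  pay_measurable : ∀ l, Measurable (pay l)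

/-- The profile in which the entries of `w` for the buyers of intermediary `l` are replaced
by `t`. -/
def DemandStructure.join {n : ℕ} (D : DemandStructure n) (l : Fin D.m) (t : D.Part l → ℝ)
    (w : Fin n → ℝ) : Fin n → ℝ :=
  fun i => if h : D.rep i = l then t ⟨i, h⟩ else w i

/-- The utility of intermediary `l` (in expectation over the lottery) when its buyers have
valuations `t`, it reports `t'`, and the others report according to `w`. -/
def Mechanism.payoff {n k : ℕ} {D : DemandStructure n} (M : Mechanism k D)
    (U : ∀ l, Utility D l) (l : Fin D.m) (t t' : D.Part l → ℝ) (w : Fin n → ℝ) : ℝ :=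
  ∑ a, (M.alloc (D.join l t' w) a).toReal * U l (a l) (M.pay l (D.join l t' w)) t

/-- Bayesian incentive compatible, individually rational and feasible mechanisms. The valuations
of different buyers are independent, so the expectation conditional on the valuations `t` of the
buyers of `l` is the integral over the other coordinates of `w`. A payoff is bounded above for
fixed `t`; a misreport whose payoff is not integrable has expected payoff `-∞`. -/
structure Mechanism.IsBIC {n k : ℕ} {D : DemandStructure n} (M : Mechanism k D) (F : ValueDist)
    (U : ∀ l, Utility D l) : Prop where
  integrable : ∀ l, ∀ᵐ t ∂(F.iid (D.Part l)), Integrable (M.payoff U l t t) (F.iid (Fin n))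
  incentive_compatible : ∀ l, ∀ᵐ t ∂(F.iid (D.Part l)), ∀ t' ∈ F.types (D.Part l),
    Integrable (M.payoff U l t t') (F.iid (Fin n)) →
      ∫ w, M.payoff U l t t' w ∂(F.iid (Fin n)) ≤ ∫ w, M.payoff U l t t w ∂(F.iid (Fin n))
  individually_rational : ∀ l, ∀ᵐ t ∂(F.iid (D.Part l)),
    0 ≤ ∫ w, M.payoff U l t t w ∂(F.iid (Fin n))
  feasible : ∀ᵐ v ∂(F.iid (Fin n)), ∀ a, M.alloc v a ≠ 0 → ∑ l, (a l : ℕ) ≤ k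

/-- The expected revenue of a mechanism. -/
def Mechanism.revenue {n k : ℕ} {D : DemandStructure n} (M : Mechanism k D) (F : ValueDist) :
    ℝ≥0∞ :=
  ∫⁻ v, ∑ l, (M.pay l v : ℝ≥0∞) ∂(F.iid (Fin n))

/-- The optimal expected revenue. -/
def optimalRevenue (F : ValueDist) {n : ℕ} (k : ℕ) (D : DemandStructure n)
    (U : ∀ l, Utility D l) : ℝ≥0∞ :=
  ⨆ (M : Mechanism k D) (_ : M.IsBIC F U), M.revenue F

/-- A `β`-robust mechanism. A mechanism that is run under every distribution and every demand
structure is given by its direct form in each of these situations. -/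
structure IsRobust {lam : ℝ} {n k : ℕ}
    (U : ∀ (_ : RegularDist lam) (D : DemandStructure n) (l : Fin D.m), Utility D l)
    (M : ∀ (_ : RegularDist lam) (D : DemandStructure n), Mechanism k D) (β : ℝ≥0) : Prop where
  isBIC : ∀ F D, (M F D).IsBIC F.toValueDist (U F D)
  robust : ∀ F D D',
    (β : ℝ≥0∞) * (M F D).revenue F.toValueDist ≤ (M F D').revenue F.toValueDist

end RobustAuction

end

noncomputable section

namespace RobustAuction

open Set Filter Topology

/-! Robustness costs a factor `β` and near-optimality under `D₀` a factor `γ`, so the point is that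
under `D₀` some BIC mechanism earns `τ/2 * c lam * (1 - 1/e)` times the welfare. One uniform price,
offered to the intermediaries in turn, does so.

Write S for the survival function and choose θ with n S(θ) = min(k, n). Relaxing the supply
constraint with multiplier θ bounds the welfare by n (θ S(θ) + ∫_θ^∞ S) (`welfare_le`). Regularity
makes the revenue curve v S(v) rise and then fall; let r be its peak on [θ, ∞). It also forces S ≤
S(r) / G beyond θ, where 1/G is the extremal tail (exponential or Pareto type) with the same peak,
whose integral over [0, ∞) is at most r / `c lam`. Hence the welfare is at most n r S(r) / `c lam`
(`exists_price_lintegral_le`).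

At price r the expected number n S(r) of willing buyers is at most k, and a fraction 1 - 1/e of it
can be served on average (`le_integral_min_numAbove`). Serving intermediaries sequentially loses a
further `τ/2`: a servable buyer is covered either by an item already sold or by demand that some
intermediary faced with enough items left, and the supply it faces is independent of its own
valuations (`le_integral_sold`).

The comparison with optimal revenue needs only individual rationality, feasibility and the fact that
intermediaries create no value (`Mechanism.IsBIC.revenue_le_welfare`). -/

/-- The probability that a valuation exceeds `v`. -/
def ValueDist.surv (F : ValueDist) (v : ℝ) : ℝ := 1 - cdf F.law v

/-! ### The survival function of a valuation -/

namespace ValueDist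

variable (F : ValueDist)

lemma law_Ioi (v : ℝ) : F.law (Ioi v) = ENNReal.ofReal (F.surv v) := by
  rw [← compl_Iic, prob_compl_eq_one_sub measurableSet_Iic, surv, cdf_eq_real,
    ENNReal.ofReal_sub _ measureReal_nonneg, ENNReal.ofReal_one, ofReal_measureReal]

instance nullSingletonClass_law : NullSingletonClass F.law := by
  unfold law
  infer_instance

lemma law_Ici (v : ℝ) : F.law (Ici v) = ENNReal.ofReal (F.surv v) := by
  rw [← F.law_Ioi, measure_congr Ioi_ae_eq_Ici]

lemma surv_nonneg (v : ℝ) : 0 ≤ F.surv v := sub_nonneg.2 (cdf_le_one _ _)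

lemma surv_le_one (v : ℝ) : F.surv v ≤ 1 := sub_le_self _ (cdf_nonneg _ _)

lemma surv_antitone : Antitone F.surv := fun _ _ h => sub_le_sub_left (monotone_cdf _ h) _

lemma integrable_density : Integrable F.density := by
  refine ⟨F.density_measurable.aestronglyMeasurable, ?_⟩
  rw [hasFiniteIntegral_iff_ofReal (Eventually.of_forall F.density_nonneg), F.lintegral_density]
  exact ENNReal.one_lt_top

lemma real_law_apply {s : Set ℝ} (hs : MeasurableSet s) :
    F.law.real s = ∫ v in s, F.density v := by
  rw [measureReal_def, law, withDensity_apply _ hs, integral_eq_lintegral_of_nonneg_ae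
    (Eventually.of_forall F.density_nonneg) F.density_measurable.aestronglyMeasurable]

lemma surv_eq (a b : ℝ) : F.surv b = F.surv a - ∫ v in a..b, F.density v := by
  have h := intervalIntegral.integral_Iic_sub_Iic (μ := volume)
    (F.integrable_density.integrableOn (s := Iic a)) (F.integrable_density.integrableOn (s := Iic b))
  rw [← h, surv, surv, cdf_eq_real, cdf_eq_real, F.real_law_apply measurableSet_Iic,
    F.real_law_apply measurableSet_Iic]
  ring

lemma surv_absolutelyContinuous (a b : ℝ) : AbsolutelyContinuousOnInterval F.surv a b := by
  have h := (F.integrable_density.intervalIntegrable (a := a) (b := b)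
    ).absolutelyContinuousOnInterval_intervalIntegral (c := a) left_mem_uIcc
  have hc : AbsolutelyContinuousOnInterval (fun _ : ℝ => F.surv a) a b :=
    (LipschitzWith.const (F.surv a)).lipschitzOnWith.absolutelyContinuousOnInterval (K := 0)
  have e : F.surv = (fun _ => F.surv a) - fun x => ∫ v in a..x, F.density v := by
    funext x
    exact F.surv_eq a x
  rw [e]
  exact hc.sub h

lemma surv_continuous : Continuous F.surv := by
  have : F.surv = fun x => F.surv 0 - ∫ v in (0 : ℝ)..x, F.density v := by
    ext x; exact F.surv_eq 0 x
  rw [this]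
  exact continuous_const.sub (intervalIntegral.continuous_primitive
    (fun a b => F.integrable_density.intervalIntegrable) 0)

lemma surv_ae_hasDerivAt : ∀ᵐ x, HasDerivAt F.surv (-F.density x) x := by
  filter_upwards [LocallyIntegrable.ae_hasDerivAt_integral F.integrable_density.locallyIntegrable] with x hx
  have : F.surv = fun x => F.surv 0 - ∫ v in (0 : ℝ)..x, F.density v := by
    ext x; exact F.surv_eq 0 x
  rw [this]
  exact (hx 0).const_sub _

lemma surv_lo : F.surv F.lo = 1 := by
  have h : ∫ v in Iio F.lo, F.density v = 0 :=
    setIntegral_eq_zero_of_forall_eq_zero fun v hv => F.density_eq_zero v (Or.inl hv)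
  rw [surv, cdf_eq_real, ← measureReal_congr (Iio_ae_eq_Iic (μ := F.law) (a := F.lo)),
    F.real_law_apply measurableSet_Iio, h, sub_zero]

lemma surv_eq_zero {v : ℝ} (hv : F.hi ≤ v) : F.surv v = 0 := by
  have h : F.law (Ioi v) = 0 := by
    rw [law, withDensity_apply _ measurableSet_Ioi,
      setLIntegral_congr_fun (g := fun _ => 0) measurableSet_Ioi, lintegral_zero]
    intro x hx
    simp only [F.density_eq_zero x (Or.inr (hv.trans_lt (EReal.coe_lt_coe_iff.2 hx))),
      ENNReal.ofReal_zero]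
  rw [law_Ioi, ENNReal.ofReal_eq_zero] at h
  exact h.antisymm (F.surv_nonneg v)

lemma surv_tendsto_atTop : Tendsto F.surv atTop (𝓝 0) := by
  have := (tendsto_cdf_atTop F.law).const_sub 1
  rwa [sub_self] at this

lemma ae_mem_support : ∀ᵐ v ∂F.law, v ∈ F.support := by
  rw [law, ae_withDensity_iff (F.density_measurable.ennreal_ofReal)]
  refine Eventually.of_forall fun v hv => ?_
  by_contra h
  apply hv
  rw [F.density_eq_zero v, ENNReal.ofReal_zero]
  simp only [support, mem_ofPred_eq, not_and_or, not_le] at h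
  exact h

lemma exists_surv_eq {q : ℝ} (hq : 0 < q) (hq1 : q ≤ 1) : ∃ v, F.lo ≤ v ∧ F.surv v = q := by
  obtain ⟨b, hb, hlb⟩ := ((F.surv_tendsto_atTop.eventually_le_const hq).and
    (eventually_ge_atTop F.lo)).exists
  obtain ⟨v, hv, h⟩ := intermediate_value_Icc' hlb F.surv_continuous.continuousOn
    (⟨hb, by rwa [F.surv_lo]⟩ : q ∈ Icc (F.surv b) (F.surv F.lo))
  exact ⟨v, hv.1, h⟩

lemma lt_hi_of_surv_pos {v : ℝ} (hv : 0 < F.surv v) : (v : EReal) < F.hi := by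
  by_contra h
  exact hv.ne' (F.surv_eq_zero (not_lt.1 h))

/-- Integration by parts. The density is merely measurable, so the survival function is
differentiable only almost everywhere; absolute continuity of both factors replaces the usual
smoothness. -/
lemma surv_mul_sub {g g' : ℝ → ℝ} {a b : ℝ} (hab : a ≤ b)
    (hg : ∀ x ∈ Icc a b, HasDerivAt g (g' x) x) (hg' : ContinuousOn g' (Icc a b)) :
    F.surv b * g b - F.surv a * g a =
      ∫ x in Ioo a b, (F.surv x * g' x - F.density x * g x) := by
  obtain ⟨C, hC⟩ := isCompact_Icc.exists_bound_of_continuousOn hg'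
  have hgac : AbsolutelyContinuousOnInterval g a b := by
    refine LipschitzOnWith.absolutelyContinuousOnInterval (K := C.toNNReal) ?_
    rw [uIcc_of_le hab]
    refine (convex_Icc a b).lipschitzOnWith_of_nnnorm_hasDerivWithin_le (f' := g')
      (fun x hx => (hg x hx).hasDerivWithinAt) fun x hx => ?_
    rw [← NNReal.coe_le_coe, coe_nnnorm]
    exact (hC x hx).trans (Real.le_coe_toNNReal C)
  rw [← (F.surv_absolutelyContinuous a b).integral_deriv_mul_eq_sub hgac,
    intervalIntegral.integral_of_le hab, integral_Ioc_eq_integral_Ioo]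
  refine setIntegral_congr_ae measurableSet_Ioo ?_
  filter_upwards [F.surv_ae_hasDerivAt] with x hx hxm
  rw [hx.deriv, (hg x (Ioo_subset_Icc_self hxm)).deriv]
  ring

end ValueDist

/-! ### The extremal profile and its integral -/

/-- The reciprocal of the survival function of the extremal `lam`-regular distribution with
monopoly price `r`. -/
lemma exists_profile {lam : ℝ} (h0 : 0 ≤ lam) (h1 : lam < 1) {r : ℝ} (hr : 0 < r) :
    ∃ G : ℝ → ℝ, (∀ v, 0 ≤ v → 0 < G v) ∧ G r = 1 ∧ G 0 = c lam ∧
      ∀ v, 0 ≤ v → HasDerivAt G (G v / ((1 - lam) * r + lam * v)) v := by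
  rcases h0.eq_or_lt with rfl | h0
  · refine ⟨fun v => Real.exp (v / r - 1), fun v _ => Real.exp_pos _, ?_, ?_, fun v _ => ?_⟩
    · simp [hr.ne']
    · simp [c]
    · have := (((hasDerivAt_id v).div_const r).sub_const 1).exp
      refine this.congr_deriv ?_
      simp [div_eq_mul_inv]
  · have hpos : ∀ v, 0 ≤ v → 0 < (1 - lam) + lam * v / r := fun v hv => by
      have : 0 ≤ lam * v / r := by positivity
      linarith
    refine ⟨fun v => ((1 - lam) + lam * v / r) ^ (1 / lam),
      fun v hv => Real.rpow_pos_of_pos (hpos v hv) _, ?_, ?_, fun v hv => ?_⟩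
    · simp [hr.ne']
    · simp [c, h0.ne']
    · have h := ((((hasDerivAt_id v).const_mul lam).div_const r).const_add (1 - lam)).rpow_const
        (p := 1 / lam) (Or.inl (hpos v hv).ne')
      refine h.congr_deriv ?_
      have hp := hpos v hv
      simp only [id]
      rw [Real.rpow_sub_one hp.ne']
      have hp' : (1 - lam) * r + lam * v ≠ 0 := by
        have : 0 < (1 - lam) * r := mul_pos (sub_pos.2 h1) hr
        positivity
      have e : (1 - lam) + lam * v / r = ((1 - lam) * r + lam * v) / r := by field_simp
      rw [e]
      field_simp

lemma c_pos {lam : ℝ} (h1 : lam < 1) : 0 < c lam := by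
  unfold c
  split_ifs
  · exact Real.exp_pos _
  · exact Real.rpow_pos_of_pos (sub_pos.2 h1) _

lemma lintegral_inv_profile_le {lam : ℝ} (h0 : 0 ≤ lam) (h1 : lam < 1) {r : ℝ} (hr : 0 < r)
    {G : ℝ → ℝ} (hG : ∀ v, 0 ≤ v → 0 < G v) (hG0 : G 0 = c lam)
    (hG' : ∀ v, 0 ≤ v → HasDerivAt G (G v / ((1 - lam) * r + lam * v)) v) :
    ∫⁻ v in Ioi 0, ENNReal.ofReal (G v)⁻¹ ≤ ENNReal.ofReal (r / c lam) := by
  have h1' : 0 < 1 - lam := sub_pos.2 h1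
  have hA : ∀ v, 0 ≤ v → 0 < (1 - lam) * r + lam * v := fun v hv => by positivity
  have hcont : ContinuousOn (fun v => (G v)⁻¹) (Ici 0) := fun v hv =>
    ((hG' v hv).continuousAt.inv₀ (hG v hv).ne').continuousWithinAt
  have key : ∀ N : ℝ, 0 ≤ N → ∫⁻ v in Ioc 0 N, ENNReal.ofReal (G v)⁻¹ ≤
      ENNReal.ofReal (r / c lam) := by
    intro N hN
    have hint : IntervalIntegrable (fun v => (G v)⁻¹) volume 0 N :=
      (hcont.mono (by rw [uIcc_of_le hN]; exact Icc_subset_Ici_self)).intervalIntegrable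
    -- With A(v) = (1 - lam) r + lam v, the equation G' = G / A gives (A / G)' = (lam - 1) / G, so
    -- -A / ((1 - lam) G) is an antiderivative; its value at 0 produces r / `c lam`.
    have hFTC : ∫ v in (0 : ℝ)..N, (G v)⁻¹ =
        -(((1 - lam) * r + lam * N) * (G N)⁻¹ / (1 - lam)) -
          -(((1 - lam) * r + lam * 0) * (G 0)⁻¹ / (1 - lam)) := by
      refine intervalIntegral.integral_eq_sub_of_hasDerivAt
        (f := fun v => -(((1 - lam) * r + lam * v) * (G v)⁻¹ / (1 - lam))) (fun v hv => ?_) hint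
      rw [uIcc_of_le hN] at hv
      have hGv := (hG v hv.1).ne'
      have := (((((hasDerivAt_id v).const_mul lam).const_add ((1 - lam) * r)).mul
        ((hG' v hv.1).inv hGv)).div_const (1 - lam)).neg
      refine this.congr_deriv ?_
      have := (hA v hv.1).ne'
      simp only [id, Pi.inv_apply]
      field_simp
      ring
    rw [← ofReal_integral_eq_lintegral_ofReal, ← intervalIntegral.integral_of_le hN, hFTC]
    · apply ENNReal.ofReal_le_ofReal
      have : 0 ≤ ((1 - lam) * r + lam * N) * (G N)⁻¹ / (1 - lam) :=
        div_nonneg (mul_nonneg (hA N hN).le (inv_nonneg.2 (hG N hN).le)) h1'.le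
      have e : ((1 - lam) * r + lam * 0) * (G 0)⁻¹ / (1 - lam) = r / c lam := by
        rw [hG0]; field_simp; ring
      rw [e]
      linarith
    · exact (intervalIntegrable_iff_integrableOn_Ioc_of_le hN).1 hint
    · exact (ae_restrict_iff' measurableSet_Ioc).2
        (Eventually.of_forall fun v hv => inv_nonneg.2 (hG v hv.1.le).le)
  have hU : Ioi (0 : ℝ) = ⋃ N : ℕ, Ioc 0 (N : ℝ) := by
    ext x
    simp only [mem_Ioi, mem_iUnion, mem_Ioc]
    exact ⟨fun h => (exists_nat_ge x).imp fun N hN => ⟨h, hN⟩, fun ⟨_, h, _⟩ => h⟩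
  rw [hU, setLIntegral_iUnion_of_directed]
  · exact iSup_le fun N => key N N.cast_nonneg
  · exact directed_of_isDirected_le fun i j hij =>
      Ioc_subset_Ioc_right (Nat.cast_le.2 hij)

/-- There is no distribution whose revenue `v * surv v` decreases from `v = 0` on. -/
lemma ValueDist.exists_mul_density_le (F : ValueDist) (h0 : F.lo = 0) :
    ∃ v, F.lo < v ∧ (v : EReal) < F.hi ∧ v * F.density v ≤ F.surv v := by
  by_contra! h
  -- The median serves only as a point d > 0 with positive survival: a revenue curve starting at 0
  -- and decreasing up to d would give d S(d) ≤ 0.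
  obtain ⟨d, hd, hSd⟩ := F.exists_surv_eq (q := 1 / 2) (by norm_num) (by norm_num)
  have hd0 : F.lo ≠ d := fun e => by
    rw [← e, F.surv_lo] at hSd
    norm_num at hSd
  have hdpos : 0 < d := h0 ▸ lt_of_le_of_ne hd hd0
  have hhi : (d : EReal) < F.hi := F.lt_hi_of_surv_pos (by rw [hSd]; norm_num)
  have key := F.surv_mul_sub (g := fun v => v) (g' := fun _ => 1) hdpos.le
    (fun x _ => hasDerivAt_id x) continuousOn_const
  have : ∫ x in Ioo 0 d, (F.surv x * 1 - F.density x * x) ≤ 0 := by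
    refine setIntegral_nonpos measurableSet_Ioo fun x hx => ?_
    have := h x (h0 ▸ hx.1) ((EReal.coe_lt_coe_iff.2 hx.2).trans hhi)
    linarith
  rw [← key, hSd] at this
  linarith

/-! ### The monopoly price above a threshold -/

namespace RegularDist

variable {lam : ℝ} (F : RegularDist lam)

/-- The price is the peak of the revenue curve on [θ, ∞). The two inequalities compare the hazard
rate with that of the extremal profile, and say that S G increases up to r and decreases afterwards.
-/
lemma exists_price (h1 : lam < 1) {θ : ℝ} (hθ : F.lo ≤ θ) (hS : 0 < F.surv θ) :
    ∃ r, θ ≤ r ∧ 0 < r ∧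
      (∀ v, θ < v → v < r → F.density v * ((1 - lam) * r + lam * v) ≤ F.surv v) ∧
      (∀ v : ℝ, r < v → (v : EReal) < F.hi →
        F.surv v ≤ F.density v * ((1 - lam) * r + lam * v)) := by
  have h1' : 0 < 1 - lam := sub_pos.2 h1
  set φ : ℝ → ℝ := fun v => lam * v - (1 - cdf F.law v) / F.density v with hφ
  have hmono : MonotoneOn φ {v : ℝ | F.lo < v ∧ (v : EReal) < F.hi} := F.regular
  have hφv : ∀ v, φ v = lam * v - F.surv v / F.density v := fun v => rfl
  -- The condition on φ is v f(v) ≤ S(v) rearranged: the points where the revenue curve does not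
  -- decrease.
  set A : Set ℝ := {v | (F.lo < v ∧ (v : EReal) < F.hi) ∧ φ v ≤ -(1 - lam) * v} with hA
  have hθhi := F.lt_hi_of_surv_pos hS
  have hbdd : BddAbove A := by
    obtain ⟨v₀, hv₀, hv₀'⟩ := EReal.lt_iff_exists_real_btwn.1 F.lo_lt_hi
    have hv₀ := EReal.coe_lt_coe_iff.1 hv₀
    refine ⟨max v₀ (-φ v₀ / (1 - lam)), fun v hv => ?_⟩
    rcases le_total v v₀ with h | h
    · exact h.trans (le_max_left _ _)
    · refine le_max_of_le_right ?_
      rw [le_div_iff₀ h1']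
      have h2 := hmono ⟨hv₀, hv₀'⟩ hv.1 h
      have h3 := hv.2
      linarith
  have hloA : ∀ v ∈ A, 0 < v := fun v hv => F.lo_nonneg.trans_lt hv.1.1
  -- If `A` is empty, its real supremum is 0 and the maximum is θ, since θ ≥ 0.
  refine ⟨max (sSup A) θ, le_max_right _ _, ?_, ?_, ?_⟩
  · by_contra hneg
    obtain ⟨hs, ht⟩ := max_le_iff.1 (not_lt.1 hneg)
    have hlo0 : F.lo = 0 := le_antisymm (hθ.trans ht) F.lo_nonneg
    obtain ⟨v, hv, hv', h⟩ := F.toValueDist.exists_mul_density_le hlo0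
    have hvA : v ∈ A := by
      refine ⟨⟨hv, hv'⟩, ?_⟩
      have := (le_div_iff₀ (F.density_pos v hv hv')).2 h
      rw [hφv]
      linarith
    exact absurd (hloA v hvA) (not_lt.2 ((le_csSup hbdd hvA).trans hs))
  · intro v hv hvr
    have hvs : v < sSup A := by
      rcases lt_max_iff.1 hvr with h | h
      · exact h
      · exact absurd h hv.le.not_gt
    have hne : A.Nonempty := by
      by_contra h
      rw [not_nonempty_iff_eq_empty.1 h, Real.sSup_empty] at hvs
      exact absurd hvs (not_lt.2 ((F.lo_nonneg.trans hθ).trans hv.le))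
    rw [max_eq_left (hv.trans hvs).le]
    have hvm : F.lo < v ∧ (v : EReal) < F.hi := by
      obtain ⟨u, hu, hvu⟩ := exists_lt_of_lt_csSup hne hvs
      exact ⟨hθ.trans_lt hv, (EReal.coe_lt_coe_iff.2 hvu).trans hu.1.2⟩
    have hf := F.density_pos v hvm.1 hvm.2
    -- Points u > v of `A` satisfy φ(v) ≤ φ(u) ≤ -(1 - lam) u; let u tend to the supremum.
    have key : (1 - lam) * sSup A ≤ -φ v := by
      rw [← le_div_iff₀' h1']
      refine le_of_forall_lt fun x hx => ?_
      obtain ⟨u, hu, hvu⟩ := exists_lt_of_lt_csSup hne (max_lt hx hvs)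
      have h2 := hmono hvm hu.1 ((le_max_right _ _).trans hvu.le)
      have h3 := hu.2
      refine ((le_max_left _ _).trans_lt hvu).trans_le ?_
      rw [le_div_iff₀ h1']
      linarith
    rw [hφv] at key
    rw [← le_div_iff₀' hf]
    linarith
  · intro v hv hvhi
    obtain ⟨hvs, hvθ⟩ := max_lt_iff.1 hv
    have hvm : F.lo < v ∧ (v : EReal) < F.hi := ⟨hθ.trans_lt hvθ, hvhi⟩
    have hf := F.density_pos v hvm.1 hvm.2
    -- Points u just above the price lie outside `A`, so φ(v) ≥ φ(u) > -(1 - lam) u; let u decrease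
    -- to the price.
    have key : -φ v ≤ (1 - lam) * max (sSup A) θ := by
      rw [← div_le_iff₀' h1']
      refine le_of_forall_gt fun x hx => ?_
      obtain ⟨u, hu, hu'⟩ := exists_between (lt_min hx hv)
      have hum : F.lo < u ∧ (u : EReal) < F.hi :=
        ⟨hθ.trans_lt ((le_max_right _ _).trans_lt hu),
          (EReal.coe_lt_coe_iff.2 (hu'.trans_le (min_le_right _ _))).trans hvhi⟩
      have huA : u ∉ A := fun h =>
        ((le_csSup hbdd h).trans (le_max_left _ _)).not_gt hu
      have h3 : -(1 - lam) * u < φ u := by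
        by_contra h
        exact huA ⟨hum, not_lt.1 h⟩
      have h2 := hmono hum hvm (hu'.le.trans (min_le_right _ _))
      refine lt_of_le_of_lt ?_ (hu'.trans_le (min_le_left _ _))
      rw [div_le_iff₀ h1']
      linarith
    rw [hφv] at key
    rw [← div_le_iff₀' hf]
    linarith

/-- Some price above `θ` extracts the fraction `c lam` of the welfare created by selling to all
buyers with valuation at least `θ`. -/
lemma exists_price_lintegral_le (h0 : 0 ≤ lam) (h1 : lam < 1) {θ : ℝ} (hθ : F.lo ≤ θ)
    (hS : 0 < F.surv θ) :
    ∃ r, θ ≤ r ∧ 0 < r ∧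
      ENNReal.ofReal (θ * F.surv θ) + ∫⁻ v in Ioi θ, ENNReal.ofReal (F.surv v) ≤
        ENNReal.ofReal (r * F.surv r / c lam) := by
  obtain ⟨r, hθr, hr, hlow, hhigh⟩ := F.exists_price h1 hθ hS
  obtain ⟨G, hG, hGr, hG0, hG'⟩ := exists_profile h0 h1 hr
  refine ⟨r, hθr, hr, ?_⟩
  have hθ0 : 0 ≤ θ := F.lo_nonneg.trans hθ
  have h1' : 0 < 1 - lam := sub_pos.2 h1
  have hA : ∀ v, 0 ≤ v → 0 < (1 - lam) * r + lam * v := fun v hv => by positivity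
  have hcont : ∀ a b : ℝ, 0 ≤ a →
      ContinuousOn (fun v => G v / ((1 - lam) * r + lam * v)) (Icc a b) := fun a b ha v hv =>
    ((hG' v (ha.trans hv.1)).continuousAt.div (by fun_prop)
      (hA v (ha.trans hv.1)).ne').continuousWithinAt
  have hmono : MonotoneOn G (Ici 0) := by
    refine monotoneOn_of_deriv_nonneg (convex_Ici 0)
      (fun v hv => (hG' v hv).continuousAt.continuousWithinAt)
      (fun v hv => (hG' v (interior_subset hv)).differentiableAt.differentiableWithinAt)
      fun v hv => ?_
    have hv := interior_subset hv
    rw [(hG' v hv).deriv]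
    exact (div_pos (hG v hv) (hA v hv)).le
  have hrw : ∀ x, 0 ≤ x → F.surv x * (G x / ((1 - lam) * r + lam * x)) - F.density x * G x =
      G x / ((1 - lam) * r + lam * x) *
        (F.surv x - F.density x * ((1 - lam) * r + lam * x)) := fun x hx => by
    have := (hA x hx).ne'
    field_simp
  -- S G is maximal at r, where G = 1.
  have hbound : ∀ v, θ ≤ v → F.surv v ≤ F.surv r * (G v)⁻¹ := by
    intro v hv
    have hv0 := hθ0.trans hv
    rw [← div_eq_mul_inv, le_div_iff₀ (hG v hv0)]
    rcases le_total v r with hvr | hvr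
    · have h := F.surv_mul_sub hvr (fun x hx => hG' x (hv0.trans hx.1)) (hcont v r hv0)
      have : 0 ≤ ∫ x in Ioo v r, (F.surv x * (G x / ((1 - lam) * r + lam * x)) -
          F.density x * G x) := by
        refine setIntegral_nonneg measurableSet_Ioo fun x hx => ?_
        have hx0 := hv0.trans hx.1.le
        rw [hrw x hx0]
        exact mul_nonneg (div_pos (hG x hx0) (hA x hx0)).le
          (sub_nonneg.2 (hlow x (hv.trans_lt hx.1) hx.2))
      rw [← h, hGr] at this
      linarith
    · rcases le_or_gt F.hi (v : EReal) with hvhi | hvhi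
      · rw [F.surv_eq_zero hvhi, zero_mul]
        exact F.surv_nonneg r
      · have h := F.surv_mul_sub hvr (fun x hx => hG' x (hr.le.trans hx.1)) (hcont r v hr.le)
        have : ∫ x in Ioo r v, (F.surv x * (G x / ((1 - lam) * r + lam * x)) -
            F.density x * G x) ≤ 0 := by
          refine setIntegral_nonpos measurableSet_Ioo fun x hx => ?_
          have hx0 := hr.le.trans hx.1.le
          rw [hrw x hx0]
          exact mul_nonpos_of_nonneg_of_nonpos (div_pos (hG x hx0) (hA x hx0)).le
            (sub_nonpos.2 (hhigh x hx.1 ((EReal.coe_lt_coe_iff.2 hx.2).trans hvhi)))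
        rw [← h, hGr] at this
        linarith
  -- As G is increasing, the bound at θ also holds with G(v) for v < θ; thus both terms together are
  -- controlled by the integral of 1/G over the whole half-line.
  have e1 : ENNReal.ofReal (θ * F.surv θ) = ∫⁻ _ in Ioc 0 θ, ENNReal.ofReal (F.surv θ) := by
    rw [setLIntegral_const, Real.volume_Ioc, sub_zero, mul_comm,
      ENNReal.ofReal_mul (F.surv_nonneg θ)]
  have hSr := F.surv_nonneg r
  calc ENNReal.ofReal (θ * F.surv θ) + ∫⁻ v in Ioi θ, ENNReal.ofReal (F.surv v)
      ≤ (∫⁻ v in Ioc 0 θ, ENNReal.ofReal (F.surv r) * ENNReal.ofReal (G v)⁻¹) +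
          ∫⁻ v in Ioi θ, ENNReal.ofReal (F.surv r) * ENNReal.ofReal (G v)⁻¹ := by
        rw [e1]
        gcongr ?_ + ?_
        · refine setLIntegral_mono' measurableSet_Ioc fun v hv => ?_
          rw [← ENNReal.ofReal_mul hSr]
          refine ENNReal.ofReal_le_ofReal ((hbound θ le_rfl).trans ?_)
          exact mul_le_mul_of_nonneg_left
            (inv_anti₀ (hG v hv.1.le) (hmono hv.1.le hθ0 hv.2)) hSr
        · refine setLIntegral_mono' measurableSet_Ioi fun v hv => ?_
          rw [← ENNReal.ofReal_mul hSr]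
          exact ENNReal.ofReal_le_ofReal (hbound v (le_of_lt hv))
    _ = ∫⁻ v in Ioi 0, ENNReal.ofReal (F.surv r) * ENNReal.ofReal (G v)⁻¹ := by
        rw [← lintegral_union measurableSet_Ioi
          (Ioc_disjoint_Ioi le_rfl), Ioc_union_Ioi_eq_Ioi hθ0]
    _ = ENNReal.ofReal (F.surv r) * ∫⁻ v in Ioi 0, ENNReal.ofReal (G v)⁻¹ :=
        lintegral_const_mul' _ _ ENNReal.ofReal_ne_top
    _ ≤ ENNReal.ofReal (F.surv r) * ENNReal.ofReal (r / c lam) := by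
        gcongr
        exact lintegral_inv_profile_le h0 h1 hr hG hG0 hG'
    _ = ENNReal.ofReal (r * F.surv r / c lam) := by
        rw [← ENNReal.ofReal_mul hSr]
        congr 1
        ring

end RegularDist

/-! ### The surplus of unit-demand buyers -/

section Surplus

variable {ι : Type} [Fintype ι]

lemma bddAbove_surplus (x : ℕ) (v : ι → ℝ) :
    BddAbove ((fun z : ι → ℝ => ∑ i, v i * z i) ''
      {z | (∀ i, z i ∈ Icc (0 : ℝ) 1) ∧ ∑ i, z i ≤ (x : ℝ)}) := by
  refine ⟨∑ i, |v i|, ?_⟩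
  rintro _ ⟨z, ⟨hz, -⟩, rfl⟩
  refine Finset.sum_le_sum fun i _ => (le_abs_self _).trans ?_
  rw [abs_mul, abs_of_nonneg (hz i).1]
  exact mul_le_of_le_one_right (abs_nonneg _) (hz i).2

lemma le_surplus (x : ℕ) (v : ι → ℝ) {z : ι → ℝ} (hz : ∀ i, z i ∈ Icc (0 : ℝ) 1)
    (hx : ∑ i, z i ≤ (x : ℝ)) : ∑ i, v i * z i ≤ surplus x v :=
  le_csSup (bddAbove_surplus x v) ⟨z, ⟨hz, hx⟩, rfl⟩

lemma surplus_nonneg (x : ℕ) (v : ι → ℝ) : 0 ≤ surplus x v := by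
  simpa using le_surplus x v (z := fun _ => 0) (by simp) (by simp)

lemma surplus_le_of_forall {x : ℕ} {v : ι → ℝ} {b : ℝ}
    (h : ∀ z : ι → ℝ, (∀ i, z i ∈ Icc (0 : ℝ) 1) → ∑ i, z i ≤ (x : ℝ) → ∑ i, v i * z i ≤ b) :
    surplus x v ≤ b := by
  refine csSup_le ⟨_, fun _ => 0, by simp, rfl⟩ ?_
  rintro _ ⟨z, ⟨hz, hx⟩, rfl⟩
  exact h z hz hx

lemma surplus_mono {x y : ℕ} (h : x ≤ y) (v : ι → ℝ) : surplus x v ≤ surplus y v :=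
  surplus_le_of_forall fun _ hz hx => le_surplus y v hz (hx.trans (Nat.cast_le.2 h))

/-- Lagrangian relaxation: each unit is charged θ, and every buyer keeps the positive part of its
excess over θ without any supply limit. -/
lemma surplus_le (x : ℕ) (v : ι → ℝ) {θ : ℝ} (hθ : 0 ≤ θ) :
    surplus x v ≤ (min x (Fintype.card ι) : ℕ) * θ + ∑ i, max (v i - θ) 0 := by
  refine surplus_le_of_forall fun z hz hx => ?_
  have h1 : ∑ i, z i ≤ ((min x (Fintype.card ι) : ℕ) : ℝ) := by
    rw [Nat.cast_min]
    refine le_min hx ?_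
    calc ∑ i, z i ≤ ∑ _i : ι, (1 : ℝ) := Finset.sum_le_sum fun i _ => (hz i).2
      _ = Fintype.card ι := by simp
  calc ∑ i, v i * z i = (∑ i, z i) * θ + ∑ i, (v i - θ) * z i := by
        rw [Finset.sum_mul, ← Finset.sum_add_distrib]
        exact Finset.sum_congr rfl fun i _ => by ring
    _ ≤ _ := by
        gcongr with i
        calc (v i - θ) * z i ≤ max (v i - θ) 0 * z i :=
              mul_le_mul_of_nonneg_right (le_max_left _ _) (hz i).1
          _ ≤ max (v i - θ) 0 := mul_le_of_le_one_right (le_max_right _ _) (hz i).2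

lemma exists_surplus_eq (x : ℕ) (v : ι → ℝ) :
    ∃ z : ι → ℝ, (∀ i, z i ∈ Icc (0 : ℝ) 1) ∧ ∑ i, z i ≤ (x : ℝ) ∧
      surplus x v = ∑ i, v i * z i := by
  have hK : IsCompact {z : ι → ℝ | (∀ i, z i ∈ Icc (0 : ℝ) 1) ∧ ∑ i, z i ≤ (x : ℝ)} := by
    have : {z : ι → ℝ | (∀ i, z i ∈ Icc (0 : ℝ) 1) ∧ ∑ i, z i ≤ (x : ℝ)} =
        (univ.pi fun _ => Icc (0 : ℝ) 1) ∩ {z | ∑ i, z i ≤ (x : ℝ)} := by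
      ext z; simp [-Set.pi_univ_Icc]
    rw [this]
    exact (isCompact_univ_pi fun _ => isCompact_Icc).inter_right
      (isClosed_le (by fun_prop) continuous_const)
  obtain ⟨z, hz, hmax⟩ := hK.exists_isMaxOn ⟨fun _ => 0, by simp⟩
    (f := fun z : ι → ℝ => ∑ i, v i * z i) (by fun_prop)
  refine ⟨z, hz.1, hz.2, le_antisymm (surplus_le_of_forall fun y hy hx => hmax ⟨hy, hx⟩)
    (le_surplus x v hz.1 hz.2)⟩

/-- An uncountable supremum of continuous functions is lower semicontinuous, hence measurable. -/
lemma measurable_surplus (x : ℕ) : Measurable fun v : ι → ℝ => surplus x v := by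
  have h : LowerSemicontinuous fun v : ι → ℝ =>
      ⨆ z : {z : ι → ℝ | (∀ i, z i ∈ Icc (0 : ℝ) 1) ∧ ∑ i, z i ≤ (x : ℝ)},
        ∑ i, v i * z.1 i := by
    refine lowerSemicontinuous_ciSup (fun v => ?_) fun z => Continuous.lowerSemicontinuous
      (by fun_prop)
    have := bddAbove_surplus x v
    rwa [image_eq_range] at this
  convert h.measurable using 2 with v
  rw [surplus, sSup_image']

end Surplus

/-! ### The ex-ante bound on welfare -/

lemma ValueDist.lintegral_max_sub (F : ValueDist) (θ : ℝ) :
    ∫⁻ v, ENNReal.ofReal (max (v - θ) 0) ∂F.law =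
      ∫⁻ v in Ioi θ, ENNReal.ofReal (F.surv v) := by
  rw [lintegral_eq_lintegral_meas_lt (f := fun v => max (v - θ) 0) _ (Eventually.of_forall fun v => le_max_right _ _)
    (by fun_prop)]
  have h : ∀ t ∈ Ioi (0 : ℝ), F.law {v | t < max (v - θ) 0} = ENNReal.ofReal (F.surv (t + θ)) := by
    intro t ht
    rw [← F.law_Ioi]
    congr 1
    ext v
    simp only [mem_ofPred_eq, lt_max_iff, mem_Ioi]
    constructor
    · rintro (h | h)
      · linarith
      · exact absurd h (not_lt.2 (le_of_lt ht))
    · intro h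
      left
      linarith
  rw [setLIntegral_congr_fun measurableSet_Ioi h]
  have := (measurePreserving_add_right (volume : Measure ℝ) θ).setLIntegral_comp_preimage
    (s := Ioi θ) measurableSet_Ioi
    (f := fun v => ENNReal.ofReal (F.surv v)) F.surv_continuous.measurable.ennreal_ofReal
  rw [← this]
  congr 2
  ext t
  simp

instance (F : ValueDist) (ι : Type) [Fintype ι] : IsProbabilityMeasure (F.iid ι) := by
  unfold ValueDist.iid
  infer_instance

lemma ValueDist.measurePreserving_eval (F : ValueDist) {ι : Type} [Fintype ι] (i : ι) :
    MeasurePreserving (Function.eval i) (F.iid ι) F.law :=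
  MeasureTheory.measurePreserving_eval (fun _ => F.law) i

lemma ValueDist.ae_mem_types (F : ValueDist) (ι : Type) [Fintype ι] :
    ∀ᵐ t ∂(F.iid ι), t ∈ F.types ι := by
  simp only [types, mem_ofPred_eq]
  rw [ae_all_iff]
  exact fun i => (F.measurePreserving_eval i).quasiMeasurePreserving.ae F.ae_mem_support

lemma welfare_le (F : ValueDist) (n k : ℕ) {θ : ℝ} (hθ : 0 ≤ θ)
    (h : ((min k n : ℕ) : ℝ) = n * F.surv θ) :
    welfare F n k ≤ n * (ENNReal.ofReal (θ * F.surv θ) +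
      ∫⁻ v in Ioi θ, ENNReal.ofReal (F.surv v)) := by
  calc welfare F n k
      ≤ ∫⁻ v, (ENNReal.ofReal ((min k n : ℕ) * θ) +
          ∑ i, ENNReal.ofReal (max (v i - θ) 0)) ∂(F.iid (Fin n)) := by
        refine lintegral_mono fun v => ?_
        rw [← ENNReal.ofReal_sum_of_nonneg fun i _ => le_max_right _ _,
          ← ENNReal.ofReal_add (by positivity)
            (Finset.sum_nonneg fun i _ => le_max_right _ _)]
        refine ENNReal.ofReal_le_ofReal ((surplus_le k v hθ).trans_eq ?_)
        rw [Fintype.card_fin]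
    _ = ENNReal.ofReal ((min k n : ℕ) * θ) +
          ∑ i : Fin n, ∫⁻ v, ENNReal.ofReal (max (v i - θ) 0) ∂(F.iid (Fin n)) := by
        rw [lintegral_add_left measurable_const, lintegral_finsetSum _ fun i _ => by fun_prop,
          lintegral_const, measure_univ, mul_one]
    _ = _ := by
        have : ∀ i : Fin n, ∫⁻ v, ENNReal.ofReal (max (v i - θ) 0) ∂(F.iid (Fin n)) =
            ∫⁻ v in Ioi θ, ENNReal.ofReal (F.surv v) := fun i => by
          rw [← F.lintegral_max_sub]
          exact (F.measurePreserving_eval i).lintegral_comp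
            (f := fun x => ENNReal.ofReal (max (x - θ) 0)) (by fun_prop)
        simp only [this, Finset.sum_const, Finset.card_univ, Fintype.card_fin, nsmul_eq_mul]
        rw [h, mul_add, mul_assoc, ENNReal.ofReal_mul n.cast_nonneg, ENNReal.ofReal_natCast,
          mul_comm (F.surv θ)]

/-! ### How many willing buyers a limited supply can serve -/

section NumAbove

variable {ι : Type} [Fintype ι]

lemma numAbove_eq_sum (r : ℝ≥0) (t : ι → ℝ) :
    numAbove r t = ∑ i, if (r : ℝ) ≤ t i then 1 else 0 := by
  classical
  rw [numAbove, Nat.card_eq_fintype_card, Fintype.card_subtype, Finset.card_filter]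

lemma measurable_numAbove (r : ℝ≥0) : Measurable fun t : ι → ℝ => numAbove r t := by
  simp only [numAbove_eq_sum]
  refine Finset.measurable_sum _ fun i _ => ?_
  exact Measurable.ite (measurableSet_le measurable_const (measurable_pi_apply i))
    measurable_const measurable_const

lemma integrable_of_nat_le {α : Type*} [MeasurableSpace α] {μ : Measure α} [IsFiniteMeasure μ]
    {f : α → ℕ} (hf : Measurable f) {b : ℕ} (h : ∀ a, f a ≤ b) :
    Integrable (fun a => (f a : ℝ)) μ :=
  Integrable.of_bound (C := b) (measurable_from_top.comp hf).aestronglyMeasurable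
    (Eventually.of_forall fun a => by
      rw [Real.norm_natCast]
      exact Nat.cast_le.2 (h a))

/-- If each of at most `k` (in expectation) buyers is willing to pay `r`, then at least the fraction
`1 - 1 / e` of this expected number can be served with `k` items. -/
lemma le_integral_min_numAbove (F : ValueDist) {k : ℕ} (hk : 0 < k) (r : ℝ≥0)
    (h : Fintype.card ι * F.surv r ≤ k) :
    (1 - 1 / Real.exp 1) * (Fintype.card ι * F.surv r) ≤
      ∫ t, ((min (numAbove r t) k : ℕ) : ℝ) ∂(F.iid ι) := by
  have hk0 : (0 : ℝ) < k := Nat.cast_pos.2 hk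
  have hk1 : (1 : ℝ) ≤ k := Nat.one_le_cast.2 hk
  have hq0 : (0 : ℝ) ≤ 1 - 1 / k := sub_nonneg.2 ((div_le_one hk0).2 hk1)
  have hq1 : (1 - 1 / k : ℝ) ≤ 1 := sub_le_self _ (by positivity)
  -- The left side is the expected number of occupied bins when each willing buyer is thrown into
  -- one of k bins uniformly. It exceeds neither count, and its product form makes the expectation
  -- explicit.
  have hpt : ∀ t : ι → ℝ, (k : ℝ) * (1 - ∏ i, if (r : ℝ) ≤ t i then (1 - 1 / k : ℝ) else 1) ≤
      ((min (numAbove r t) k : ℕ) : ℝ) := by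
    intro t
    have e : (∏ i, if (r : ℝ) ≤ t i then (1 - 1 / k : ℝ) else 1) =
        (1 - 1 / k : ℝ) ^ numAbove r t := by
      rw [numAbove_eq_sum, ← Finset.prod_pow_eq_pow_sum]
      refine Finset.prod_congr rfl fun i _ => ?_
      split_ifs <;> simp
    rw [e, Nat.cast_min]
    refine le_min ?_ ?_
    · have := one_add_mul_le_pow (a := -(1 / k : ℝ)) (by linarith) (numAbove r t)
      rw [← sub_eq_add_neg] at this
      calc (k : ℝ) * (1 - (1 - 1 / k : ℝ) ^ numAbove r t)
          ≤ k * (numAbove r t * (1 / k)) := by gcongr; linarith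
        _ = numAbove r t := by field_simp
    · exact mul_le_of_le_one_right hk0.le (sub_le_self _ (pow_nonneg hq0 _))
  have hmeas : Measurable fun v : ℝ => if (r : ℝ) ≤ v then (1 - 1 / k : ℝ) else 1 :=
    Measurable.ite measurableSet_Ici measurable_const measurable_const
  have hone : ∫ v, (if (r : ℝ) ≤ v then (1 - 1 / k : ℝ) else 1) ∂F.law = 1 - F.surv r / k := by
    have e : (fun v : ℝ => if (r : ℝ) ≤ v then (1 - 1 / k : ℝ) else 1) =
        fun v => 1 - (Ici (r : ℝ)).indicator (fun _ => 1 / (k : ℝ)) v := by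
      ext v
      by_cases hv : (r : ℝ) ≤ v <;> simp [hv, indicator]
    rw [e, integral_sub (integrable_const _) ((integrable_const _).indicator measurableSet_Ici),
      integral_indicator measurableSet_Ici, setIntegral_const, measureReal_def, F.law_Ici,
      ENNReal.toReal_ofReal (F.surv_nonneg _)]
    simp [div_eq_mul_inv]
  have hprod : ∫ t, (∏ i, if (r : ℝ) ≤ t i then (1 - 1 / k : ℝ) else 1) ∂(F.iid ι) =
      (1 - F.surv r / k) ^ Fintype.card ι := by
    rw [ValueDist.iid, integral_fintype_prod_eq_prod
      (f := fun _ v => if (r : ℝ) ≤ v then (1 - 1 / k : ℝ) else 1)]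
    simp only [hone, Finset.prod_const, Finset.card_univ]
  have hint : Integrable (fun t : ι → ℝ => ∏ i, if (r : ℝ) ≤ t i then (1 - 1 / k : ℝ) else 1)
      (F.iid ι) := by
    refine Integrable.of_bound (C := 1) (Measurable.aestronglyMeasurable ?_)
      (Eventually.of_forall fun t => ?_)
    · exact Finset.measurable_prod _ fun i _ => hmeas.comp (measurable_pi_apply i)
    · rw [Real.norm_eq_abs, Finset.abs_prod]
      refine Finset.prod_le_one (fun i _ => abs_nonneg _) fun i _ => ?_
      split_ifs
      · rwa [abs_of_nonneg hq0]
      · simp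
  have hle := integral_mono (μ := F.iid ι) (((integrable_const (1 : ℝ)).sub hint).const_mul (k : ℝ))
    (integrable_of_nat_le ((measurable_numAbove r).min measurable_const)
      fun t => min_le_right _ _) hpt
  refine le_trans ?_ hle
  simp only [Pi.sub_apply]
  rw [integral_const_mul, integral_sub (integrable_const _) hint, hprod, integral_const, probReal_univ,
    one_smul]
  set p := F.surv r
  set x : ℝ := Fintype.card ι * p / k with hx
  have hp0 : 0 ≤ p := F.surv_nonneg r
  have hx0 : 0 ≤ x := by positivity
  have hx1 : x ≤ 1 := (div_le_one hk0).2 h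
  have h2 : (1 - p / k) ^ Fintype.card ι ≤ Real.exp (-x) := by
    have hpk : p / k ≤ 1 := (div_le_one hk0).2 ((F.surv_le_one r).trans hk1)
    calc (1 - p / k) ^ Fintype.card ι ≤ Real.exp (-(p / k)) ^ Fintype.card ι := by
          exact pow_le_pow_left₀ (sub_nonneg.2 hpk) (Real.one_sub_le_exp_neg _) _
      _ = Real.exp (-x) := by
          rw [← Real.exp_nat_mul, hx]
          congr 1
          ring
  -- The chord of the exponential between -1 and 0; this is where x ≤ 1 is needed.
  have h3 : Real.exp (-x) ≤ 1 - (1 - 1 / Real.exp 1) * x := by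
    have := convexOn_exp.2 (mem_univ (0 : ℝ)) (mem_univ (-1 : ℝ)) (sub_nonneg.2 hx1) hx0
      (by ring)
    simp only [smul_eq_mul, mul_zero, mul_neg, mul_one, zero_add, Real.exp_zero,
      Real.exp_neg] at this
    rw [Real.exp_neg, one_div]
    linarith
  have hxk : Fintype.card ι * p = k * x := by
    rw [hx]; field_simp
  rw [hxk]
  have : (1 - 1 / Real.exp 1) * x ≤ 1 - (1 - p / k) ^ Fintype.card ι := by linarith
  calc _ = (k : ℝ) * ((1 - 1 / Real.exp 1) * x) := by ring
    _ ≤ _ := by gcongr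

end NumAbove

/-! ### Splitting and resampling profiles by intermediary -/

namespace DemandStructure

variable {n : ℕ} (D : DemandStructure n)

/-- The valuations of the buyers whom `l` represents. -/
def part (l : Fin D.m) (v : Fin n → ℝ) : D.Part l → ℝ := fun i => v i

@[simp]
lemma part_join (l : Fin D.m) (t : D.Part l → ℝ) (w : Fin n → ℝ) :
    D.part l (D.join l t w) = t := by
  ext ⟨i, hi⟩
  simp [part, join, hi]

lemma part_join_of_ne {l l' : Fin D.m} (h : l' ≠ l) (t : D.Part l → ℝ) (w : Fin n → ℝ) :
    D.part l' (D.join l t w) = D.part l' w := by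
  ext ⟨i, hi⟩
  simp [part, join, hi, h]

lemma measurable_part (l : Fin D.m) : Measurable (D.part l) :=
  measurable_pi_lambda _ fun _ => measurable_pi_apply _

lemma measurable_join (l : Fin D.m) :
    Measurable fun q : (D.Part l → ℝ) × (Fin n → ℝ) => D.join l q.1 q.2 := by
  refine measurable_pi_lambda _ fun i => ?_
  by_cases h : D.rep i = l
  · simp only [join, h, dite_true]
    exact (measurable_pi_apply _).comp measurable_fst
  · simp only [join, h, dite_false]
    exact (measurable_pi_apply _).comp measurable_snd

lemma measurable_join_right (l : Fin D.m) (t : D.Part l → ℝ) : Measurable (D.join l t) :=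
  (D.measurable_join l).comp measurable_prodMk_left

/-- Independence across buyers in usable form: resampling the block of `l` leaves the joint law
unchanged, which turns interim statements into ex-ante ones. -/
lemma measurePreserving_join (F : ValueDist) (l : Fin D.m) :
    MeasurePreserving (fun q : (D.Part l → ℝ) × (Fin n → ℝ) => D.join l q.1 q.2)
      ((F.iid (D.Part l)).prod (F.iid (Fin n))) (F.iid (Fin n)) := by
  refine ⟨D.measurable_join l, ?_⟩
  refine (Measure.pi_eq fun s hs => ?_).symm
  rw [Measure.map_apply (D.measurable_join l) (MeasurableSet.univ_pi hs)]
  have e : (fun q : (D.Part l → ℝ) × (Fin n → ℝ) => D.join l q.1 q.2) ⁻¹' (univ.pi s) =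
      (univ.pi fun i : D.Part l => s i) ×ˢ
        (univ.pi fun i => if D.rep i = l then univ else s i) := by
    ext ⟨t, w⟩
    simp only [mem_preimage, mem_univ_pi, mem_prod, join]
    constructor
    · refine fun h => ⟨fun i => ?_, fun i => ?_⟩
      · have := h i
        rwa [dif_pos i.2] at this
      · have := h i
        split_ifs with hi
        · trivial
        · rwa [dif_neg hi] at this
    · rintro ⟨h1, h2⟩ i
      split_ifs with hi
      · exact h1 ⟨i, hi⟩
      · have := h2 i
        rwa [if_neg hi] at this
  rw [e, Measure.prod_prod, ValueDist.iid, ValueDist.iid, Measure.pi_pi, Measure.pi_pi]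
  have h1 : ∏ i : D.Part l, F.law (s i) = ∏ i, if D.rep i = l then F.law (s i) else 1 := by
    rw [← Finset.prod_filter]
    exact (Finset.prod_subtype (Finset.univ.filter fun i => D.rep i = l) (by simp)
      fun i => F.law (s i)).symm
  rw [h1, ← Finset.prod_mul_distrib]
  refine Finset.prod_congr rfl fun i _ => ?_
  split_ifs <;> simp

lemma lintegral_join (F : ValueDist) (l : Fin D.m) {g : (Fin n → ℝ) → ℝ≥0∞} (hg : Measurable g) :
    ∫⁻ v, g v ∂(F.iid (Fin n)) =
      ∫⁻ t, ∫⁻ w, g (D.join l t w) ∂(F.iid (Fin n)) ∂(F.iid (D.Part l)) := by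
  rw [← (D.measurePreserving_join F l).lintegral_comp hg]
  exact lintegral_prod _ (hg.comp (D.measurable_join l)).aemeasurable

lemma sum_part {α : Type*} [AddCommMonoid α] (f : Fin n → α) :
    ∑ l, ∑ i : D.Part l, f i = ∑ i, f i := by
  rw [← Finset.sum_fiberwise Finset.univ D.rep f]
  exact Finset.sum_congr rfl fun l _ => (Finset.sum_subtype _ (by simp) _).symm

/-- Optimal assignments inside the parts glue to a feasible assignment for all buyers. -/
lemma sum_surplus_le {k : ℕ} {a : Fin D.m → ℕ} (ha : ∑ l, a l ≤ k) (v : Fin n → ℝ) :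
    ∑ l, surplus (a l) (D.part l v) ≤ surplus k v := by
  choose z hz hza hzv using fun l => exists_surplus_eq (a l) (D.part l v)
  have e : ∀ l (i : D.Part l), z (D.rep i) ⟨i, rfl⟩ = z l i := by
    rintro l ⟨i, rfl⟩
    rfl
  have h := le_surplus k v (z := fun i => z (D.rep i) ⟨i, rfl⟩) (fun i => hz _ _) ?_
  · refine le_trans (le_of_eq ?_) h
    rw [← D.sum_part]
    refine Finset.sum_congr rfl fun l _ => ?_
    rw [hzv]
    refine Finset.sum_congr rfl fun i _ => ?_
    rw [e l i]
    rfl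
  · rw [← D.sum_part]
    calc ∑ l, ∑ i : D.Part l, z (D.rep i) ⟨i, rfl⟩ = ∑ l, ∑ i, z l i :=
          Finset.sum_congr rfl fun l _ => Finset.sum_congr rfl fun i _ => e l i
      _ ≤ ∑ l, (a l : ℝ) := Finset.sum_le_sum fun l _ => hza l
      _ ≤ k := by exact_mod_cast ha

end DemandStructure

/-! ### Revenue is at most welfare -/

section Welfare

variable {n k : ℕ} {D : DemandStructure n}

/-- The expected value of the items that `l` gets. -/
def Mechanism.value (M : Mechanism k D) (l : Fin D.m) (v : Fin n → ℝ) : ℝ :=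
  ∑ a, (M.alloc v a).toReal * surplus (a l : ℕ) (D.part l v)

lemma Mechanism.value_nonneg (M : Mechanism k D) (l : Fin D.m) (v : Fin n → ℝ) :
    0 ≤ M.value l v :=
  Finset.sum_nonneg fun _ _ => mul_nonneg ENNReal.toReal_nonneg (surplus_nonneg _ _)

lemma Mechanism.measurable_value (M : Mechanism k D) (l : Fin D.m) : Measurable (M.value l) :=
  Finset.measurable_fun_sum _ fun a _ =>
    (M.alloc_measurable a).ennreal_toReal.mul
      ((measurable_surplus _).comp (D.measurable_part l))

lemma _root_.PMF.sum_toReal_eq_one {α : Type*} [Fintype α] (p : PMF α) :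
    ∑ a, (p a).toReal = 1 := by
  rw [← ENNReal.toReal_sum fun a _ => p.apply_ne_top a, ← tsum_fintype (L := .unconditional _),
    p.tsum_coe, ENNReal.toReal_one]

lemma Mechanism.value_le (M : Mechanism k D) (l : Fin D.m) (v : Fin n → ℝ) :
    M.value l v ≤ surplus k (D.part l v) := by
  calc M.value l v ≤ ∑ a, (M.alloc v a).toReal * surplus k (D.part l v) := by
        refine Finset.sum_le_sum fun a _ => mul_le_mul_of_nonneg_left
          (surplus_mono (Nat.lt_succ_iff.1 (a l).2) _) ENNReal.toReal_nonneg
    _ = _ := by rw [← Finset.sum_mul, PMF.sum_toReal_eq_one, one_mul]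

/-- Pointwise, the payment is at most value minus payoff; averaging over the other buyers, the
payoff drops out by individual rationality. -/
lemma Mechanism.IsBIC.lintegral_pay_le {F : ValueDist} {U : ∀ l, Utility D l} {M : Mechanism k D}
    (hM : M.IsBIC F U) {l : Fin D.m} (hU : ∀ t ∈ F.types (D.Part l), ∀ x ≤ k, ∀ p : ℝ≥0,
      U l x p t ≤ surplus x t - p) :
    ∫⁻ v, (M.pay l v : ℝ≥0∞) ∂(F.iid (Fin n)) ≤
      ∫⁻ v, ENNReal.ofReal (M.value l v) ∂(F.iid (Fin n)) := by
  rw [D.lintegral_join F l (M.pay_measurable l).coe_nnreal_ennreal,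
    D.lintegral_join F l (M.measurable_value l).ennreal_ofReal]
  refine lintegral_mono_ae ?_
  filter_upwards [hM.integrable l, hM.individually_rational l, F.ae_mem_types (D.Part l)]
    with t hint hir ht
  have hle : ∀ w, (M.pay l (D.join l t w) : ℝ) ≤ M.value l (D.join l t w) - M.payoff U l t t w := by
    intro w
    have : M.payoff U l t t w ≤ ∑ a, (M.alloc (D.join l t w) a).toReal *
        (surplus (a l : ℕ) t - M.pay l (D.join l t w)) :=
      Finset.sum_le_sum fun a _ => mul_le_mul_of_nonneg_left
        (hU t ht _ (Nat.lt_succ_iff.1 (a l).2) _) ENNReal.toReal_nonneg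
    simp only [mul_sub, Finset.sum_sub_distrib, ← Finset.sum_mul, PMF.sum_toReal_eq_one,
      one_mul] at this
    have e : M.value l (D.join l t w) =
        ∑ a, (M.alloc (D.join l t w) a).toReal * surplus (a l : ℕ) t := by
      simp only [Mechanism.value, D.part_join]
    linarith
  -- For fixed `t` the value is bounded by `surplus k t`, so no moment assumption on the
  -- distribution is needed.
  have hvint : Integrable (fun w => M.value l (D.join l t w)) (F.iid (Fin n)) := by
    refine Integrable.of_bound (C := surplus k t)
      ((M.measurable_value l).comp (D.measurable_join_right l t)).aestronglyMeasurable
      (Eventually.of_forall fun w => ?_)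
    rw [Real.norm_of_nonneg (M.value_nonneg _ _)]
    simpa using M.value_le l (D.join l t w)
  calc ∫⁻ w, (M.pay l (D.join l t w) : ℝ≥0∞) ∂(F.iid (Fin n))
      ≤ ∫⁻ w, ENNReal.ofReal (M.value l (D.join l t w) - M.payoff U l t t w) ∂(F.iid (Fin n)) := by
        refine lintegral_mono fun w => ?_
        rw [← ENNReal.ofReal_coe_nnreal]
        exact ENNReal.ofReal_le_ofReal (hle w)
    _ = ENNReal.ofReal (∫ w, (M.value l (D.join l t w) - M.payoff U l t t w) ∂(F.iid (Fin n))) :=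
        (ofReal_integral_eq_lintegral_ofReal (hvint.sub hint)
          (Eventually.of_forall fun w => (NNReal.coe_nonneg _).trans (hle w))).symm
    _ ≤ ENNReal.ofReal (∫ w, M.value l (D.join l t w) ∂(F.iid (Fin n))) := by
        rw [integral_sub hvint hint]
        exact ENNReal.ofReal_le_ofReal (sub_le_self _ hir)
    _ = _ := ofReal_integral_eq_lintegral_ofReal hvint
        (Eventually.of_forall fun w => M.value_nonneg _ _)

lemma Mechanism.IsBIC.revenue_le_welfare {F : ValueDist} {U : ∀ l, Utility D l}
    {M : Mechanism k D} (hM : M.IsBIC F U) (hU : ∀ l, ∀ t ∈ F.types (D.Part l), ∀ x ≤ k,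
      ∀ p : ℝ≥0, U l x p t ≤ surplus x t - p) :
    M.revenue F ≤ welfare F n k := by
  calc M.revenue F = ∑ l, ∫⁻ v, (M.pay l v : ℝ≥0∞) ∂(F.iid (Fin n)) :=
        lintegral_finsetSum _ fun l _ => (M.pay_measurable l).coe_nnreal_ennreal
    _ ≤ ∑ l, ∫⁻ v, ENNReal.ofReal (M.value l v) ∂(F.iid (Fin n)) :=
        Finset.sum_le_sum fun l _ => hM.lintegral_pay_le (hU l)
    _ = ∫⁻ v, ENNReal.ofReal (∑ l, M.value l v) ∂(F.iid (Fin n)) := by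
        rw [← lintegral_finsetSum _ fun l _ => (M.measurable_value l).ennreal_ofReal]
        exact lintegral_congr fun v =>
          (ENNReal.ofReal_sum_of_nonneg fun l _ => M.value_nonneg l v).symm
    _ ≤ welfare F n k := by
        refine lintegral_mono_ae ?_
        filter_upwards [hM.feasible] with v hv
        refine ENNReal.ofReal_le_ofReal ?_
        calc ∑ l, M.value l v =
            ∑ a, (M.alloc v a).toReal * ∑ l, surplus (a l : ℕ) (D.part l v) := by
              simp only [Mechanism.value, Finset.mul_sum]
              exact Finset.sum_comm
          _ ≤ ∑ a, (M.alloc v a).toReal * surplus k v := by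
              refine Finset.sum_le_sum fun a _ => ?_
              by_cases ha : M.alloc v a = 0
              · simp [ha]
              · exact mul_le_mul_of_nonneg_left (D.sum_surplus_le (hv a ha) v)
                  ENNReal.toReal_nonneg
          _ = surplus k v := by rw [← Finset.sum_mul, PMF.sum_toReal_eq_one, one_mul]

lemma optimalRevenue_le_welfare {F : ValueDist} {U : ∀ l, Utility D l}
    (hU : ∀ l, ∀ t ∈ F.types (D.Part l), ∀ x ≤ k, ∀ p : ℝ≥0, U l x p t ≤ surplus x t - p) :
    optimalRevenue F k D U ≤ welfare F n k :=
  iSup₂_le fun _ hM => hM.revenue_le_welfare hU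

end Welfare

/-! ### Sequential posted pricing -/

/-- Measurable demands of all intermediaries, depending on the available supply. -/
structure DemandSystem {n : ℕ} (D : DemandStructure n) where
  dem : ∀ l : Fin D.m, ℕ → (D.Part l → ℝ) → ℕ
  measurable : ∀ l s, Measurable (dem l s)
  le_supply : ∀ l s t, dem l s t ≤ s

namespace DemandSystem

variable {n : ℕ} {D : DemandStructure n} (E : DemandSystem D) (k : ℕ)

/-- The number of items sold to the first `j` intermediaries when they are served in turn. -/
def sold (v : Fin n → ℝ) : ℕ → ℕ
  | 0 => 0
  | j + 1 => sold v j + if h : j < D.m then E.dem ⟨j, h⟩ (k - sold v j) (D.part ⟨j, h⟩ v) else 0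

/-- The number of items that `l` buys when the intermediaries are served in turn. -/
def bought (l : Fin D.m) (v : Fin n → ℝ) : ℕ := E.dem l (k - E.sold k v l) (D.part l v)

lemma sold_le (v : Fin n → ℝ) (j : ℕ) : E.sold k v j ≤ k := by
  induction j with
  | zero => exact Nat.zero_le _
  | succ j ih =>
    rw [sold]
    split_ifs with h
    · have := E.le_supply ⟨j, h⟩ (k - E.sold k v j) (D.part ⟨j, h⟩ v)
      omega
    · exact ih

lemma sold_mono (v : Fin n → ℝ) : Monotone (E.sold k v) :=
  monotone_nat_of_le_succ fun _ => Nat.le_add_right _ _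

lemma sum_bought (v : Fin n → ℝ) : ∑ l, E.bought k l v = E.sold k v D.m := by
  have h : ∀ j, E.sold k v j = ∑ i ∈ Finset.range j,
      if h : i < D.m then E.bought k ⟨i, h⟩ v else 0 := by
    intro j
    induction j with
    | zero => rfl
    | succ j ih => rw [Finset.sum_range_succ, ← ih]; rfl
  rw [h, Finset.sum_range]
  exact Finset.sum_congr rfl fun l _ => by simp

lemma bought_le (l : Fin D.m) (v : Fin n → ℝ) : E.bought k l v ≤ k :=
  (E.le_supply _ _ _).trans (Nat.sub_le _ _)

lemma measurable_dem_comp {α : Type*} [MeasurableSpace α] (l : Fin D.m) {s : α → ℕ}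
    {t : α → D.Part l → ℝ} (hs : Measurable s) (ht : Measurable t) :
    Measurable fun a => E.dem l (s a) (t a) := by
  have h : Measurable fun q : ℕ × (D.Part l → ℝ) => E.dem l q.1 q.2 :=
    measurable_from_prod_countable_right fun s => E.measurable l s
  exact h.comp (hs.prodMk ht)

lemma measurable_sold (j : ℕ) : Measurable fun v => E.sold k v j := by
  induction j with
  | zero => exact measurable_const
  | succ j ih =>
    simp only [sold]
    by_cases h : j < D.m
    · simp only [h, dite_true]
      exact ih.add (E.measurable_dem_comp _ (measurable_const.sub ih) (D.measurable_part _))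
    · simpa only [h, dite_false, add_zero] using ih

lemma measurable_bought (l : Fin D.m) : Measurable (E.bought k l) :=
  E.measurable_dem_comp l (measurable_const.sub (E.measurable_sold k l)) (D.measurable_part l)

/-- The supply offered to `l` is fixed by its predecessors, so it is independent of the valuations
and the report of `l`. Incentives and the revenue bound both rest on this. -/
lemma sold_join (l : Fin D.m) (t : D.Part l → ℝ) (w : Fin n → ℝ) {j : ℕ} (hj : j ≤ l) :
    E.sold k (D.join l t w) j = E.sold k w j := by
  induction j with
  | zero => rfl
  | succ j ih =>
    have hne : ∀ h : j < D.m, (⟨j, h⟩ : Fin D.m) ≠ l := fun h e => by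
      rw [← e] at hj
      exact absurd hj (Nat.not_succ_le_self j)
    simp only [sold, ih (Nat.le_of_succ_le hj)]
    congr 1
    split_ifs with h
    · rw [D.part_join_of_ne (hne h)]
    · rfl

lemma bought_join (l : Fin D.m) (t : D.Part l → ℝ) (w : Fin n → ℝ) :
    E.bought k l (D.join l t w) = E.dem l (k - E.sold k w l) t := by
  rw [bought, E.sold_join k l t w le_rfl, D.part_join]

/-- The mechanism that offers the remaining items at the uniform price `r` to one intermediary
after the other. -/
def postedPrice (r : ℝ≥0) : Mechanism k D where
  alloc v := PMF.pure fun l => ⟨E.bought k l v, Nat.lt_succ_of_le (E.bought_le k l v)⟩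
  pay l v := E.bought k l v * r
  alloc_measurable a := by
    classical
    have h : Measurable fun v => (fun l => (⟨E.bought k l v,
        Nat.lt_succ_of_le (E.bought_le k l v)⟩ : Fin (k + 1))) := by
      refine measurable_pi_lambda _ fun l => ?_
      have : Measurable fun v => (Fin.ofNat (k + 1) (E.bought k l v)) :=
        (measurable_from_top (f := Fin.ofNat (k + 1))).comp (E.measurable_bought k l)
      convert this using 2 with v
      exact Fin.ext (Nat.mod_eq_of_lt (Nat.lt_succ_of_le (E.bought_le k l v))).symm
    simp only [PMF.pure_apply]
    exact Measurable.ite (measurableSet_eq_fun measurable_const h) measurable_const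
      measurable_const
  pay_measurable l :=
    (measurable_from_top.comp (E.measurable_bought k l)).mul measurable_const

lemma payoff_postedPrice (r : ℝ≥0) (U : ∀ l, Utility D l) (l : Fin D.m) (t t' : D.Part l → ℝ)
    (w : Fin n → ℝ) :
    (E.postedPrice k r).payoff U l t t' w =
      U l (E.dem l (k - E.sold k w l) t') (E.dem l (k - E.sold k w l) t' * r) t := by
  classical
  rw [Mechanism.payoff, Finset.sum_eq_single fun j =>
    ⟨E.bought k j (D.join l t' w), Nat.lt_succ_of_le (E.bought_le k j _)⟩]
  · simp [postedPrice, bought_join]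
  · intro a _ ha
    simp [postedPrice, PMF.pure_apply, ha]
  · simp

/-- Any report only selects a quantity within the same remaining supply at the same price, so truth
is optimal for every realization of the others; buying nothing gives individual rationality. -/
lemma isBIC_postedPrice {F : ValueDist} {r : ℝ≥0} {U : ∀ l, Utility D l}
    (h0 : ∀ l, ∀ t ∈ F.types (D.Part l), U l 0 0 t = 0)
    (hopt : ∀ l, ∀ s ≤ k, ∀ t ∈ F.types (D.Part l), ∀ x ≤ s,
      U l x (x * r) t ≤ U l (E.dem l s t) (E.dem l s t * r) t) :
    (E.postedPrice k r).IsBIC F U := by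
  have hint : ∀ l (t : D.Part l → ℝ),
      Integrable ((E.postedPrice k r).payoff U l t t) (F.iid (Fin n)) := by
    intro l t
    have e : (E.postedPrice k r).payoff U l t t =
        (fun s : ℕ => U l (E.dem l (k - s) t) (E.dem l (k - s) t * r) t) ∘
          fun w => E.sold k w l := funext fun w => E.payoff_postedPrice k r U l t t w
    rw [e]
    -- For fixed `t` the payoff depends only on the number sold before, which takes finitely many
    -- values.
    refine Integrable.of_bound
      (C := ∑ s ∈ Finset.range (k + 1), ‖U l (E.dem l (k - s) t) (E.dem l (k - s) t * r) t‖)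
      (measurable_from_top.comp (E.measurable_sold k l)).aestronglyMeasurable
      (Eventually.of_forall fun w => ?_)
    exact Finset.single_le_sum
      (f := fun s => ‖U l (E.dem l (k - s) t) (E.dem l (k - s) t * r) t‖)
      (fun s _ => norm_nonneg _)
      (Finset.mem_range.2 (Nat.lt_succ_of_le (E.sold_le k w l)))
  refine ⟨fun l => Eventually.of_forall (hint l), fun l => ?_, fun l => ?_, ?_⟩
  · filter_upwards [F.ae_mem_types (D.Part l)] with t ht t' _ hint'
    refine integral_mono hint' (hint l t) fun w => ?_
    simp only [payoff_postedPrice]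
    exact hopt l _ (Nat.sub_le _ _) t ht _ (E.le_supply _ _ _)
  · filter_upwards [F.ae_mem_types (D.Part l)] with t ht
    refine integral_nonneg fun w => ?_
    simp only [payoff_postedPrice, Pi.zero_apply]
    have := hopt l (k - E.sold k w l) (Nat.sub_le _ _) t ht 0 (Nat.zero_le _)
    rwa [Nat.cast_zero, zero_mul, h0 l t ht] at this
  · refine Eventually.of_forall fun v a ha => ?_
    have : a = fun l => ⟨E.bought k l v, Nat.lt_succ_of_le (E.bought_le k l v)⟩ := by
      by_contra hne
      exact ha (by classical simp [postedPrice, PMF.pure_apply, hne])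
    rw [this]
    exact (E.sum_bought k v).trans_le (E.sold_le k v _)

lemma integrable_sold (F : ValueDist) (j : ℕ) :
    Integrable (fun v => (E.sold k v j : ℝ)) (F.iid (Fin n)) :=
  integrable_of_nat_le (E.measurable_sold k j) fun v => E.sold_le k v j

lemma revenue_postedPrice (F : ValueDist) (r : ℝ≥0) :
    (E.postedPrice k r).revenue F =
      ENNReal.ofReal (r * ∫ v, (E.sold k v D.m : ℝ) ∂(F.iid (Fin n))) := by
  rw [← integral_const_mul, ofReal_integral_eq_lintegral_ofReal
    ((E.integrable_sold k F D.m).const_mul _) (Eventually.of_forall fun v => by positivity)]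
  refine lintegral_congr fun v => ?_
  rw [← E.sum_bought, ENNReal.ofReal_mul r.coe_nonneg, ENNReal.ofReal_natCast, Nat.cast_sum, Finset.mul_sum,
    ENNReal.ofReal_coe_nnreal]
  refine Finset.sum_congr rfl fun l _ => ?_
  simp [postedPrice, mul_comm]

lemma _root_.RobustAuction.DemandStructure.integral_join (F : ValueDist) (l : Fin D.m)
    {g : (Fin n → ℝ) → ℝ} (hg : Integrable g (F.iid (Fin n))) :
    Integrable (fun w => ∫ t, g (D.join l t w) ∂(F.iid (D.Part l))) (F.iid (Fin n)) ∧
      ∫ v, g v ∂(F.iid (Fin n)) =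
        ∫ w, ∫ t, g (D.join l t w) ∂(F.iid (D.Part l)) ∂(F.iid (Fin n)) := by
  have h := (D.measurePreserving_join F l).integrable_comp_of_integrable hg
  refine ⟨h.integral_prod_right, ?_⟩
  have h2 := integral_prod_symm _ h
  refine Eq.trans ?_ h2
  have h3 := integral_map (μ := (F.iid (D.Part l)).prod (F.iid (Fin n))) (f := g)
    (D.measurable_join l).aemeasurable (by
      rw [(D.measurePreserving_join F l).map_eq]
      exact hg.aestronglyMeasurable)
  rwa [(D.measurePreserving_join F l).map_eq] at h3

/-- The demand condition concerns a deterministic supply; conditioning on the other buyers makes the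
remaining supply deterministic. -/
lemma le_integral_bought {F : ValueDist} {r : ℝ≥0} {τ : ℝ} {l : Fin D.m}
    (h : ∀ s ≤ k, τ * ∫ t, ((min (numAbove r t) s : ℕ) : ℝ) ∂(F.iid (D.Part l)) ≤
      ∫ t, (E.dem l s t : ℝ) ∂(F.iid (D.Part l))) :
    τ * ∫ v, ((min (numAbove r (D.part l v)) (k - E.sold k v l) : ℕ) : ℝ) ∂(F.iid (Fin n)) ≤
      ∫ v, (E.bought k l v : ℝ) ∂(F.iid (Fin n)) := by
  have h1 : Integrable (fun v =>
      ((min (numAbove r (D.part l v)) (k - E.sold k v l) : ℕ) : ℝ)) (F.iid (Fin n)) :=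
    integrable_of_nat_le (b := k) (((measurable_numAbove r).comp (D.measurable_part l)).min
      (measurable_const.sub (E.measurable_sold k l)))
      fun v => (min_le_right _ _).trans (Nat.sub_le _ _)
  have h2 : Integrable (fun v => (E.bought k l v : ℝ)) (F.iid (Fin n)) :=
    integrable_of_nat_le (E.measurable_bought k l) fun v => E.bought_le k l v
  obtain ⟨i1, e1⟩ := D.integral_join F l h1
  obtain ⟨i2, e2⟩ := D.integral_join F l h2
  rw [e1, e2, ← integral_const_mul]
  refine integral_mono (i1.const_mul τ) i2 fun w => ?_
  simp only [D.part_join, E.sold_join k l _ w le_rfl, bought_join]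
  exact h _ (Nat.sub_le _ _)

lemma _root_.Finset.min_sum_le_sum_min {ι : Type*} (S : Finset ι) (a : ι → ℕ) (s : ℕ) :
    min (∑ i ∈ S, a i) s ≤ ∑ i ∈ S, min (a i) s := by
  classical
  induction S using Finset.induction_on with
  | empty => simp
  | insert i S hi ih =>
    rw [Finset.sum_insert hi, Finset.sum_insert hi]
    omega

/-- Beyond the items sold, the servable buyers number at most min(N, final leftover). This splits
over the parts by subadditivity, and the leftover only shrinks along the sequence. -/
lemma min_numAbove_le (r : ℝ≥0) (v : Fin n → ℝ) :
    min (numAbove r v) k ≤ E.sold k v D.m +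
      ∑ l, min (numAbove r (D.part l v)) (k - E.sold k v l) := by
  have e : numAbove r v = ∑ l, numAbove r (D.part l v) := by
    simp only [numAbove_eq_sum]
    exact (D.sum_part fun i => if (r : ℝ) ≤ v i then 1 else 0).symm
  have h1 := Finset.min_sum_le_sum_min Finset.univ (fun l => numAbove r (D.part l v))
    (k - E.sold k v D.m)
  have h2 : ∑ l, min (numAbove r (D.part l v)) (k - E.sold k v D.m) ≤
      ∑ l, min (numAbove r (D.part l v)) (k - E.sold k v l) :=
    Finset.sum_le_sum fun l _ => min_le_min_left _
      (Nat.sub_le_sub_left (E.sold_mono k v l.2.le) k)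
  rw [← e] at h1
  omega

/-- The factor 1/2 arises because expected sales pay twice: for the items already sold, using `τ ≤
1`, and for the demand faced by the intermediaries. -/
lemma le_integral_sold {F : ValueDist} {r : ℝ≥0} {τ : ℝ} (hτ0 : 0 ≤ τ) (hτ1 : τ ≤ 1)
    (h : ∀ l, ∀ s ≤ k, τ * ∫ t, ((min (numAbove r t) s : ℕ) : ℝ) ∂(F.iid (D.Part l)) ≤
      ∫ t, (E.dem l s t : ℝ) ∂(F.iid (D.Part l))) :
    τ / 2 * ∫ v, ((min (numAbove r v) k : ℕ) : ℝ) ∂(F.iid (Fin n)) ≤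
      ∫ v, (E.sold k v D.m : ℝ) ∂(F.iid (Fin n)) := by
  have hi : ∀ l, Integrable (fun v =>
      ((min (numAbove r (D.part l v)) (k - E.sold k v l) : ℕ) : ℝ)) (F.iid (Fin n)) := fun l =>
    integrable_of_nat_le (b := k) (((measurable_numAbove r).comp (D.measurable_part l)).min
      (measurable_const.sub (E.measurable_sold k l)))
      fun v => (min_le_right _ _).trans (Nat.sub_le _ _)
  have hs := E.integrable_sold k F D.m
  have h1 : ∫ v, ((min (numAbove r v) k : ℕ) : ℝ) ∂(F.iid (Fin n)) ≤
      ∫ v, (E.sold k v D.m : ℝ) ∂(F.iid (Fin n)) +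
        ∑ l, ∫ v, ((min (numAbove r (D.part l v)) (k - E.sold k v l) : ℕ) : ℝ)
          ∂(F.iid (Fin n)) := by
    rw [← integral_finsetSum _ fun l _ => hi l, ← integral_add hs (integrable_finsetSum _
      fun l _ => hi l)]
    refine integral_mono (integrable_of_nat_le ((measurable_numAbove r).min measurable_const)
      fun t => min_le_right _ _) (hs.add (integrable_finsetSum _ fun l _ => hi l)) fun v => ?_
    have := (Nat.cast_le (α := ℝ)).2 (E.min_numAbove_le k r v)
    rwa [Nat.cast_add, Nat.cast_sum] at this
  have h2 : ∫ v, (E.sold k v D.m : ℝ) ∂(F.iid (Fin n)) =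
      ∑ l, ∫ v, (E.bought k l v : ℝ) ∂(F.iid (Fin n)) := by
    rw [← integral_finsetSum _ fun l _ => integrable_of_nat_le (E.measurable_bought k l)
      fun v => E.bought_le k l v]
    refine integral_congr_ae (Eventually.of_forall fun v => ?_)
    simp only [← E.sum_bought, Nat.cast_sum]
  have h3 := Finset.sum_le_sum fun l (_ : l ∈ Finset.univ) => E.le_integral_bought k (h l)
  rw [← h2, ← Finset.mul_sum] at h3
  have h4 : 0 ≤ ∫ v, (E.sold k v D.m : ℝ) ∂(F.iid (Fin n)) :=
    integral_nonneg fun v => Nat.cast_nonneg _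
  have h5 := mul_le_mul_of_nonneg_left h1 hτ0
  have h6 := mul_le_mul_of_nonneg_right hτ1 h4
  linarith

end DemandSystem

/-! ### From posted prices to the welfare guarantee -/

/-- The optimal revenue is at least that of a posted price. -/
lemma le_optimalRevenue {F : ValueDist} {n k : ℕ} {D : DemandStructure n} {U : ∀ l, Utility D l}
    {τ : Fin D.m → ℝ} (hU : ∀ l, IsAdmissible F k (U l) (τ l)) {τ₀ : ℝ} (hτ0 : 0 ≤ τ₀)
    (hτ1 : τ₀ ≤ 1) (hτ : ∀ l, τ₀ ≤ τ l) (r : ℝ≥0) :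
    ENNReal.ofReal (r * (τ₀ / 2 * ∫ v, ((min (numAbove r v) k : ℕ) : ℝ) ∂(F.iid (Fin n)))) ≤
      optimalRevenue F k D U := by
  -- Demands are guaranteed only for supplies up to `k`, whereas a demand system is defined for all;
  -- capping at `k` changes nothing that is used.
  choose d hd hdτ using fun l s =>
    (hU l).buyer_disconnectability r (min s k) (min_le_right s k)
  let E : DemandSystem D :=
    { dem := d
      measurable := fun l s => (hd l s).measurable
      le_supply := fun l s t => ((hd l s).le_supply t).trans (min_le_left s k) }
  have hBIC : (E.postedPrice k r).IsBIC F U := by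
    refine E.isBIC_postedPrice k (fun l => (hU l).opt_out) fun l s hs t ht x hx => ?_
    exact (hd l s).optimal t ht x (le_min hx (hx.trans hs))
  have hsold := E.le_integral_sold (F := F) (r := r) k hτ0 hτ1 fun l s hs => by
    have := hdτ l s
    rw [min_eq_left hs] at this
    refine le_trans (mul_le_mul_of_nonneg_right (hτ l) ?_) this
    exact integral_nonneg fun v => Nat.cast_nonneg _
  refine le_trans ?_ (le_iSup₂_of_le (E.postedPrice k r) hBIC le_rfl)
  rw [E.revenue_postedPrice]
  exact ENNReal.ofReal_le_ofReal (mul_le_mul_of_nonneg_left hsold r.2)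

/-- For regular distributions a posted price extracts a constant fraction of the welfare. -/
lemma RegularDist.exists_price_welfare_le {lam : ℝ} (F : RegularDist lam) (h0 : 0 ≤ lam)
    (h1 : lam < 1) (n k : ℕ) :
    ∃ r : ℝ≥0, ENNReal.ofReal (c lam * (1 - 1 / Real.exp 1)) * welfare F.toValueDist n k ≤
      ENNReal.ofReal (r * ∫ v, ((min (numAbove r v) k : ℕ) : ℝ) ∂(F.iid (Fin n))) := by
  rcases Nat.eq_zero_or_pos (min k n) with hz | hpos
  · refine ⟨0, ?_⟩
    have h : ∀ v : Fin n → ℝ, surplus k v = 0 := fun v => by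
      refine le_antisymm ?_ (surplus_nonneg k v)
      -- This multiplier dominates every valuation, so all excess terms vanish.
      have h := surplus_le k v (θ := ∑ i, |v i|) (Finset.sum_nonneg fun i _ => abs_nonneg _)
      rw [Fintype.card_fin, hz, Nat.cast_zero, zero_mul, zero_add] at h
      refine h.trans (Finset.sum_nonpos fun i _ => max_le (sub_nonpos.2 ?_) le_rfl)
      exact (le_abs_self _).trans (Finset.single_le_sum (f := fun i => |v i|)
        (fun i _ => abs_nonneg _) (Finset.mem_univ i))
    simp [welfare, h]
  · have hn : 0 < n := hpos.trans_le (min_le_right _ _)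
    have hk : 0 < k := hpos.trans_le (min_le_left _ _)
    have hn' : (0 : ℝ) < n := Nat.cast_pos.2 hn
    -- The market-clearing threshold: the expected number of buyers above θ is exactly the number of
    -- items that can be used.
    obtain ⟨θ, hθ, hSθ⟩ := F.exists_surv_eq (q := ((min k n : ℕ) : ℝ) / n)
      (div_pos (Nat.cast_pos.2 hpos) hn')
      ((div_le_one hn').2 (Nat.cast_le.2 (min_le_right _ _)))
    have hSpos : 0 < F.surv θ := hSθ ▸ div_pos (Nat.cast_pos.2 hpos) hn'
    have hq : ((min k n : ℕ) : ℝ) = n * F.surv θ := by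
      rw [hSθ]; field_simp
    obtain ⟨r, hθr, hr, hle⟩ := F.exists_price_lintegral_le h0 h1 hθ hSpos
    have hw := (welfare_le F.toValueDist n k (F.lo_nonneg.trans hθ) hq).trans
      (mul_le_mul_right hle _)
    lift r to ℝ≥0 using hr.le
    refine ⟨r, (mul_le_mul_right hw _).trans ?_⟩
    have hnum := le_integral_min_numAbove (ι := Fin n) F.toValueDist hk r (by
      rw [Fintype.card_fin]
      calc n * F.surv r ≤ n * F.surv θ := by gcongr; exact F.surv_antitone hθr
        _ = ((min k n : ℕ) : ℝ) := hq.symm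
        _ ≤ k := Nat.cast_le.2 (min_le_left _ _))
    rw [Fintype.card_fin] at hnum
    have hc := c_pos h1
    have he : 0 ≤ 1 - 1 / Real.exp 1 := by
      rw [sub_nonneg, div_le_one (Real.exp_pos _)]
      exact Real.one_le_exp zero_le_one
    rw [← ENNReal.ofReal_natCast, ← ENNReal.ofReal_mul n.cast_nonneg,
      ← ENNReal.ofReal_mul (mul_nonneg hc.le he)]
    refine ENNReal.ofReal_le_ofReal (le_trans (le_of_eq ?_)
      (mul_le_mul_of_nonneg_left hnum r.2))
    field_simp

end RobustAuction

end

theorem mainTheorem12 (lam : ℝ) (hlam0 : 0 ≤ lam) (hlam1 : lam < 1) (n k : ℕ)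
    (U : ∀ (_ : RobustAuction.RegularDist lam) (D : RobustAuction.DemandStructure n)
      (l : Fin D.m), RobustAuction.Utility D l)
    (τ : ∀ (_ : RobustAuction.RegularDist lam) (D : RobustAuction.DemandStructure n),
      Fin D.m → ℝ)
    (hU : ∀ F D l, RobustAuction.IsAdmissible F.toValueDist k (U F D l) (τ F D l))
    (M : ∀ (_ : RobustAuction.RegularDist lam) (D : RobustAuction.DemandStructure n),
      RobustAuction.Mechanism k D)
    (β γ : ℝ≥0) (hM : RobustAuction.IsRobust U M β)
    (D₀ : RobustAuction.DemandStructure n) (F : RobustAuction.RegularDist lam)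
    (happrox : (γ : ℝ≥0∞) * RobustAuction.optimalRevenue F.toValueDist k D₀ (U F D₀) ≤
      (M F D₀).revenue F.toValueDist)
    (C : ℝ≥0∞)
    (hC : C = ENNReal.ofReal
      (β * γ * (⨅ l, τ F D₀ l) * (RobustAuction.c lam / 2) * (1 - 1 / Real.exp 1)))
    (D : RobustAuction.DemandStructure n) :
    C * RobustAuction.welfare F.toValueDist n k ≤ (M F D).revenue F.toValueDist ∧
      C * RobustAuction.optimalRevenue F.toValueDist k D (U F D) ≤
        C * RobustAuction.welfare F.toValueDist n k := by
  refine ⟨?_, mul_le_mul_right (RobustAuction.optimalRevenue_le_welfare fun l =>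
    (hU F D l).no_value_created) _⟩
  set τ₀ : ℝ := ⨅ l, τ F D₀ l with hτ₀
  have hbdd : BddBelow (Set.range fun l => τ F D₀ l) := (Set.finite_range _).bddBelow
  have hτ0 : 0 ≤ τ₀ := Real.iInf_nonneg fun l => (hU F D₀ l).tau_pos.le
  have hτ : ∀ l, τ₀ ≤ τ F D₀ l := fun l => ciInf_le hbdd l
  have hτ1 : τ₀ ≤ 1 := by
    -- Without intermediaries the real infimum is 0 by convention, and the bound is trivial.
    rcases isEmpty_or_nonempty (Fin D₀.m) with h | ⟨⟨l⟩⟩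
    · rw [hτ₀, Real.iInf_of_isEmpty]
      exact zero_le_one
    · exact (hτ l).trans (hU F D₀ l).tau_le_one
  obtain ⟨r, hr⟩ := F.exists_price_welfare_le hlam0 hlam1 n k
  have hopt := RobustAuction.le_optimalRevenue (fun l => hU F D₀ l) hτ0 hτ1 hτ r
  set I := ∫ v, ((min (RobustAuction.numAbove r v) k : ℕ) : ℝ) ∂(F.iid (Fin n))
  calc C * RobustAuction.welfare F.toValueDist n k
      = β * (γ * (ENNReal.ofReal (τ₀ / 2) *
          (ENNReal.ofReal (RobustAuction.c lam * (1 - 1 / Real.exp 1)) *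
            RobustAuction.welfare F.toValueDist n k))) := by
        rw [hC, ← ENNReal.ofReal_coe_nnreal, ← ENNReal.ofReal_coe_nnreal, ← mul_assoc, ← mul_assoc,
          ← mul_assoc, ← ENNReal.ofReal_mul β.coe_nonneg, ← ENNReal.ofReal_mul (by positivity),
          ← ENNReal.ofReal_mul (by positivity)]
        congr 2
        ring
    _ ≤ β * (γ * (ENNReal.ofReal (τ₀ / 2) * ENNReal.ofReal (r * I))) := by gcongr
    _ = β * (γ * ENNReal.ofReal (r * (τ₀ / 2 * I))) := by
        rw [← ENNReal.ofReal_mul (by positivity)]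
        congr 3
        ring
    _ ≤ β * (γ * RobustAuction.optimalRevenue F.toValueDist k D₀ (U F D₀)) := by gcongr
    _ ≤ β * (M F D₀).revenue F.toValueDist := by gcongr
    _ ≤ (M F D).revenue F.toValueDist := hM.robust F D₀ D
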